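/- An AuxPDA is a nondeterministic pushdown automaton with a read-only two-way input tape and an additional work tape, such that on inputs of length $n$ the work tape length is $O(\log n)$ and every computation path has length at most $p(n)$ for some fixed polynomial $p$. It is one-way if it never moves the input head to the left. A finitely generated group $G$ belongs to the class OW-AuxPDA if, for some finite symmetric generating set $\Sigma$ of $G$, the word problem $\{w\in\Sigma^* : w=1 \text{ in } G\}$ is the language accepted by a one-way AuxPDA. Theorem. Let $G$ and $H$ be groups that belong to OW-AuxPDA. Then the free product $G*H$ belongs to OW-AuxPDA, and the direct product $G\times\mathbb{Z}$ belongs to OW-AuxPDA. -/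

import Mathlib

/-- What the input head can see: the two end markers, or a letter of the input word. -/
inductive InputSymbol (α : Type*) where
  | leftEnd : InputSymbol α
  | letter : α → InputSymbol α
  | rightEnd : InputSymbol α

/-- Movements of a head along a tape. -/
inductive HeadMove where
  | left : HeadMove
  | stay : HeadMove
  | right : HeadMove

/-- Operations on the pushdown store. -/
inductive StackOp (Γ : Type*) where
  | keep : StackOp Γ
  | pop : StackOp Γ
  | push : Γ → StackOp Γ

/-- What an automaton does in one step: change the state, move the input head, write a symbol on
the scanned work tape cell, move the work tape head, and operate on the pushdown store. -/
structure AuxPDAAction (Q W Γ : Type*) where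
  state : Q
  inputMove : HeadMove
  write : W
  workMove : HeadMove
  stackOp : StackOp Γ

/-- A nondeterministic auxiliary pushdown automaton with input alphabet `α`: a pushdown automaton
with a read-only two-way input tape (with end markers) and an additional work tape. No resource
bounds are imposed here. The possible actions depend on the state, the scanned input symbol, the
scanned work tape symbol and the topmost stack symbol (`none` if the stack is empty). -/
structure AuxPDA (α : Type*) where
  /-- states -/
  Q : Type
  /-- work tape symbols -/
  W : Type
  /-- stack symbols -/
  Γ : Type
  finite_Q : Finite Q
  finite_W : Finite W
  finite_Γ : Finite Γ
  start : Q
  accepting : Set Q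
  blank : W
  trans : Q → InputSymbol α → W → Option Γ → Set (AuxPDAAction Q W Γ)

namespace HeadMove

/-- New position of a head on a tape whose cells are numbered `0, 1, 2, …`; a head that is asked
to leave the tape on the left stays where it is. -/
def apply : HeadMove → ℕ → ℕ
  | left, p => p - 1
  | stay, p => p
  | right, p => p + 1

end HeadMove

namespace StackOp

/-- Effect on a stack, written as a list whose first entry is the topmost symbol. -/
def apply {Γ : Type*} : StackOp Γ → List Γ → List Γ
  | keep, s => s
  | pop, s => s.tail
  | push x, s => x :: s

end StackOp

namespace AuxPDA

/-- The symbol at position `p` of the input tape for `w = a₁ ⋯ aₙ`: position `0` carries the left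
end marker, position `i` with `1 ≤ i ≤ n` carries `aᵢ`, position `n + 1` the right end marker. -/
def inputAt {α : Type*} (w : List α) : ℕ → InputSymbol α
  | 0 => .leftEnd
  | p + 1 => match w[p]? with
    | some a => .letter a
    | none => .rightEnd

/-- Configurations. The work tape has the cells `0, 1, 2, …`. -/
structure Config {α : Type*} (M : AuxPDA α) where
  state : M.Q
  inputHead : ℕ
  workTape : ℕ → M.W
  workHead : ℕ
  stack : List M.Γ

/-- The initial configuration: input head on the left end marker, blank work tape with its head on
the first cell, empty stack. -/
def initial {α : Type*} (M : AuxPDA α) : M.Config where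
  state := M.start
  inputHead := 0
  workTape := fun _ => M.blank
  workHead := 0
  stack := []

/-- The configuration after an action; the input head does not go beyond the right end marker. -/
def perform {α : Type*} (M : AuxPDA α) (w : List α) (c : M.Config)
    (a : AuxPDAAction M.Q M.W M.Γ) : M.Config where
  state := a.state
  inputHead := min (a.inputMove.apply c.inputHead) (w.length + 1)
  workTape := Function.update c.workTape c.workHead a.write
  workHead := a.workMove.apply c.workHead
  stack := a.stackOp.apply c.stack

/-- One computation step on the input word `w`. -/
def Step {α : Type*} (M : AuxPDA α) (w : List α) (c c' : M.Config) : Prop :=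
  ∃ a ∈ M.trans c.state (inputAt w c.inputHead) (c.workTape c.workHead) c.stack.head?,
    c' = M.perform w c a

/-- `M.Reaches w k c`: on input `w` there is a computation path with exactly `k` steps from the
initial configuration to `c`. -/
inductive Reaches {α : Type*} (M : AuxPDA α) (w : List α) : ℕ → M.Config → Prop
  | initial : Reaches M w 0 M.initial
  | step {k : ℕ} {c c' : M.Config} : Reaches M w k c → M.Step w c c' → Reaches M w (k + 1) c'

/-- The language accepted by `M`: some computation path reaches an accepting state with the input
head on the right end marker. -/
def accepts {α : Type*} (M : AuxPDA α) : Language α :=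
  {w | ∃ k c, M.Reaches w k c ∧ c.inputHead = w.length + 1 ∧ c.state ∈ M.accepting}

/-- On inputs of length `n`, every computation path visits only the first `O(log n)` cells of the
work tape. -/
def LogspaceBounded {α : Type*} (M : AuxPDA α) : Prop :=
  ∃ C : ℕ, ∀ (w : List α) (k : ℕ) (c : M.Config), M.Reaches w k c →
    c.workHead < C * (Nat.log 2 w.length + 1)

/-- On inputs of length `n`, every computation path has length at most `p(n)`, for some
polynomial `p`. -/
def PolyTimeBounded {α : Type*} (M : AuxPDA α) : Prop :=
  ∃ p : Polynomial ℕ, ∀ (w : List α) (k : ℕ) (c : M.Config), M.Reaches w k c →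
    k ≤ p.eval w.length

/-- The input head is never moved to the left. -/
def OneWay {α : Type*} (M : AuxPDA α) : Prop :=
  ∀ q x y t, ∀ a ∈ M.trans q x y t, a.inputMove ≠ HeadMove.left

end AuxPDA

/-- `L` is accepted by a one-way, logspace bounded and polynomially time bounded AuxPDA. -/
def RecognizedByOneWayAuxPDA {α : Type*} (L : Language α) : Prop :=
  ∃ M : AuxPDA α, M.OneWay ∧ M.LogspaceBounded ∧ M.PolyTimeBounded ∧ M.accepts = L

/-- The word problem of the group `G` with respect to `S ⊆ G`: the words over `S` that evaluate
to `1`. -/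
def wordProblem {G : Type*} [Group G] (S : Set G) : Language S :=
  {w | (w.map (fun a : S => (a : G))).prod = 1}

/-- The class OW-AuxPDA of finitely generated groups: for a finite symmetric generating set, the
word problem is recognized by a one-way AuxPDA (logspace and polynomially time bounded). -/
def InOWAuxPDA (G : Type*) [Group G] : Prop :=
  ∃ S : Set G, S.Finite ∧ (∀ a ∈ S, a⁻¹ ∈ S) ∧ Subgroup.closure S = ⊤ ∧
    RecognizedByOneWayAuxPDA (wordProblem S)

/-! Free product. By the normal form theorem, a nonempty word over generators of the factors that
represents 1 in a free product contains a nonempty subword over one factor that already represents 1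
there (`Monoid.CoprodI.exists_subword_prod_eq_one`). Deleting it and repeating shows that the word
problem is the insertion closure of the union of the two word problems (`wordProblem_coprod_iff`).
It remains to see that recognized languages are closed under finite unions
(`RecognizedByOneWayAuxPDA.iUnion`) and under insertion closure
(`RecognizedByOneWayAuxPDA.insertionClosure`).

For the insertion closure, a machine runs nested copies of the given automaton. It guesses where an
inserted word begins, saves tape, head position, state and scanned symbol of the active copy on the
pushdown store, and starts a fresh copy; it also guesses where the input of a copy ends. One-wayness
makes this complete: a copy never has to go back to letters before an interruption. For the time
bound, a copy must read a letter before it may be interrupted or return, so at most n + 1 copies are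
ever started on an input of length n. Nothing is lost, because a word inserted in front of the first
letter of another one can be counted as inserted beside it (`Expansion.insert`). Space and time of a
copy are bounded on failing paths too, because what it has done is always a computation of the
automaton on the letters fed to it so far (`Fed.reaches`).

Direct product with the integers. A word is trivial exactly if its part in the first factor is
trivial and its exponents sum to 0. A second track of the work tape holds the sum in binary with
digits -1, 0, 1. Such a number is 0 only if all its digits are, so a flag computed during each
addition decides acceptance. Its value alone does not bound the length of this redundant notation; a
potential argument does: a nonzero carry out of a position uses up two nonzero units that entered
it, so a carry reaches position m only after 2 ^ m letters (`SignedDigit.Amortized.le_log`). -/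

namespace AuxPDA

/-! ### Computation paths and deterministic stretches -/

variable {α : Type*}

/-- A deterministic stretch of `k` steps: every configuration before the last one is not accepting,
has exactly one successor, and has its work head on one of the first `B` cells. -/
inductive Run (M : AuxPDA α) (w : List α) (B : ℕ) : ℕ → M.Config → M.Config → Prop
  | refl (c : M.Config) : Run M w B 0 c c
  | head {k : ℕ} {c c₁ c' : M.Config} (hstep : ∀ c₂, M.Step w c c₂ ↔ c₂ = c₁)
      (hB : c.workHead < B) (hacc : c.state ∉ M.accepting) (h : Run M w B k c₁ c') :
      Run M w B (k + 1) c c'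

namespace Run

variable {M : AuxPDA α} {w : List α} {B : ℕ}

theorem trans {k l : ℕ} {c₁ c₂ c₃ : M.Config} (h : Run M w B k c₁ c₂) (h' : Run M w B l c₂ c₃) :
    Run M w B (k + l) c₁ c₃ := by
  induction h with
  | refl c => simpa using h'
  | head hs hB ha _ ih => rw [add_right_comm]; exact .head hs hB ha (ih h')

theorem of_trans_eq {k : ℕ} {c c' : M.Config} (a : AuxPDAAction M.Q M.W M.Γ)
    (ha : M.trans c.state (inputAt w c.inputHead) (c.workTape c.workHead) c.stack.head? = {a})
    (hB : c.workHead < B) (hacc : c.state ∉ M.accepting) (h : Run M w B k (M.perform w c a) c') :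
    Run M w B (k + 1) c c' :=
  .head (fun c₂ => by simp [Step, ha]) hB hacc h

/-- A deterministic step that does not move the input head, followed by a run. -/
theorem of_stay {k h p : ℕ} {q : M.Q} {T : ℕ → M.W} {s : List M.Γ} {c' : M.Config}
    (q' : M.Q) (x : M.W) (mv : HeadMove) (op : StackOp M.Γ) (T' : ℕ → M.W) (p' : ℕ) (s' : List M.Γ)
    (ha : M.trans q (inputAt w h) (T p) s.head? = {⟨q', .stay, x, mv, op⟩})
    (hT : Function.update T p x = T') (hp : mv.apply p = p') (hs : op.apply s = s')
    (hh : h ≤ w.length + 1) (hB : p < B) (hacc : q ∉ M.accepting)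
    (hr : Run M w B k ⟨q', h, T', p', s'⟩ c') : Run M w B (k + 1) ⟨q, h, T, p, s⟩ c' := by
  subst hT hp hs
  refine .of_trans_eq _ ha hB hacc ?_
  simpa only [perform, HeadMove.apply, min_eq_left hh] using hr

theorem reflTransGen {k : ℕ} {c c' : M.Config} (h : Run M w B k c c') :
    Relation.ReflTransGen (M.Step w) c c' := by
  induction h with
  | refl c => exact .refl
  | head hs _ _ _ ih => exact .head ((hs _).2 rfl) ih

end Run

variable {M : AuxPDA α} {w : List α}

theorem exists_reaches_iff {c : M.Config} :
    (∃ k, M.Reaches w k c) ↔ Relation.ReflTransGen (M.Step w) M.initial c := by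
  constructor
  · rintro ⟨k, h⟩
    induction h with
    | initial => exact .refl
    | step _ h ih => exact ih.tail h
  · intro h
    induction h with
    | refl => exact ⟨0, .initial⟩
    | tail _ h ih => obtain ⟨k, hk⟩ := ih; exact ⟨k + 1, hk.step h⟩

theorem mem_accepts_iff : w ∈ M.accepts ↔ ∃ c, Relation.ReflTransGen (M.Step w) M.initial c ∧
    c.inputHead = w.length + 1 ∧ c.state ∈ M.accepting := by
  simp only [← exists_reaches_iff]
  constructor
  · rintro ⟨k, c, h, h'⟩; exact ⟨c, ⟨k, h⟩, h'⟩
  · rintro ⟨c, ⟨k, h⟩, h'⟩; exact ⟨k, c, h, h'⟩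

/-- If every step from a configuration satisfying `Main m` leads, after a deterministic run, to one
satisfying `Main (m + 1)`, then bounds for `Main` give bounds for all computation paths. -/
theorem reaches_of_main {N T B : ℕ} (Main : ℕ → M.Config → Prop)
    (hinit : ∃ j c, j ≤ T ∧ Run M w B j M.initial c ∧ Main 0 c)
    (hstep : ∀ m c c₁, Main m c → M.Step w c c₁ →
      ∃ j c', j ≤ T ∧ Run M w B j c₁ c' ∧ Main (m + 1) c')
    (hN : ∀ m c, Main m c → m ≤ N) (hB : ∀ m c, Main m c → c.workHead < B)
    {k : ℕ} {c : M.Config} (h : M.Reaches w k c) :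
    c.workHead < B ∧ k ≤ (N + 1) * (T + 1) ∧ (c.state ∈ M.accepting → ∃ m, Main m c) := by
  -- Every reachable configuration lies on a deterministic stretch: `i` steps of it are done, `j`
  -- remain, and it ends in the main configuration number `m`. Since the stretch is deterministic,
  -- no path can leave it.
  have key : ∃ m i j c', k ≤ m * (T + 1) + i ∧ i + j ≤ T ∧ Run M w B j c c' ∧ Main m c' := by
    induction h with
    | initial =>
      obtain ⟨j, c, hj, hr, hm⟩ := hinit
      exact ⟨0, 0, j, c, by simp, by simpa using hj, hr, hm⟩
    | @step k c c₁ _ hs ih =>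
      obtain ⟨m, i, j, c', hk, hij, hr, hm⟩ := ih
      cases hr with
      | refl =>
        obtain ⟨j', c'', hj', hr', hm'⟩ := hstep m c c₁ hm hs
        exact ⟨m + 1, 0, j', c'', by rw [add_mul]; omega, by omega, hr', hm'⟩
      | @head l _ c₂ _ hs' hB' ha hr =>
        obtain rfl := (hs' _).1 hs
        exact ⟨m, i + 1, l, c', by omega, by omega, hr, hm⟩
  obtain ⟨m, i, j, c', hk, hij, hr, hm⟩ := key
  have hmN := hN m c' hm
  refine ⟨?_, ?_, ?_⟩
  · cases hr with
    | refl => exact hB m c hm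
    | head _ h _ _ => exact h
  · have := Nat.mul_le_mul_right (T + 1) hmN
    rw [add_mul]; omega
  · intro hacc
    cases hr with
    | refl => exact ⟨m, hm⟩
    | head _ _ h _ => exact absurd hacc h

/-- Bounds the cost of clearing the stack of a simulated copy when it returns. -/
theorem Reaches.stack_length_le {k : ℕ} {c : M.Config} (h : M.Reaches w k c) :
    c.stack.length ≤ k := by
  induction h with
  | initial => simp [AuxPDA.initial]
  | @step k c c' _ hs ih =>
    obtain ⟨a, _, rfl⟩ := hs
    simp only [perform]
    cases a.stackOp <;> simp [StackOp.apply] <;> omega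

theorem inputAt_append_of_le {u v : List α} {p : ℕ} (h : p ≤ u.length) :
    inputAt (u ++ v) p = inputAt u p := by
  cases p with
  | zero => rfl
  | succ p => simp only [inputAt]; rw [List.getElem?_append_left (by omega)]

theorem inputAt_length_succ (u : List α) : inputAt u (u.length + 1) = .rightEnd := by
  simp [inputAt]

theorem inputAt_append_cons (u v : List α) (a : α) :
    inputAt (u ++ a :: v) (u.length + 1) = .letter a := by
  simp [inputAt]

end AuxPDA

theorem Polynomial.eval_nat_mono (p : Polynomial ℕ) {a b : ℕ} (h : a ≤ b) :
    p.eval a ≤ p.eval b := by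
  rw [Polynomial.eval_eq_sum, Polynomial.eval_eq_sum]
  exact Finset.sum_le_sum fun i _ => Nat.mul_le_mul_left _ (Nat.pow_le_pow_left h i)

instance InputSymbol.instFinite {α : Type*} [Finite α] : Finite (InputSymbol α) :=
  Finite.of_injective
    (fun s : InputSymbol α => (match s with
      | .leftEnd => .inl false
      | .letter a => .inr a
      | .rightEnd => .inl true : Bool ⊕ α))
    (by rintro (_ | _ | _) (_ | _ | _) h <;> simp_all)

/-! ### Insertion closure and its normal form -/

/-- The words obtained from the empty word by repeatedly inserting words of `L`. -/
inductive InsertionClosure {α : Type*} (L : Language α) : List α → Prop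
  | nil : InsertionClosure L []
  | insert {u v x : List α} (h : InsertionClosure L (u ++ v)) (hx : x ∈ L) :
      InsertionClosure L (u ++ x ++ v)

/-- `Expansion L x w`: the word `w` arises from `x` by inserting at arbitrary places expansions of
nonempty words of `L` that keep their first letter in front. -/
inductive Expansion {α : Type*} (L : Language α) : List α → List α → Prop
  | nil : Expansion L [] []
  | letter {x w : List α} (a : α) (h : Expansion L x w) : Expansion L (a :: x) (a :: w)
  | call {x y w₁ w₂ : List α} {b : α} (hy : b :: y ∈ L) (h₁ : Expansion L y w₁)
      (h₂ : Expansion L x w₂) : Expansion L x (b :: w₁ ++ w₂)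

namespace Expansion

variable {α : Type*} {L : Language α}

theorem refl (x : List α) : Expansion L x x := by
  induction x with
  | nil => exact .nil
  | cons a x ih => exact .letter a ih

theorem insert_front {x w y : List α} (h : Expansion L x w) (hy : y ∈ L) :
    Expansion L x (y ++ w) := by
  cases y with
  | nil => exact h
  | cons b y => exact .call hy (.refl y) h

/-- The point is that a nested word can always keep its first letter in front. An insertion
elsewhere is passed down to the part of the expansion in which it takes place; an insertion at the
front stays at the current level. -/
theorem insert {x w y : List α} (h : Expansion L x w) (hy : y ∈ L) (u v : List α)
    (huv : w = u ++ v) : Expansion L x (u ++ y ++ v) := by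
  induction h generalizing u v with
  | nil =>
    obtain ⟨rfl, rfl⟩ := List.append_eq_nil_iff.1 huv.symm
    exact insert_front .nil hy
  | @letter x w a h ih =>
    cases u with
    | nil => subst huv; exact insert_front (.letter a h) hy
    | cons a' u =>
      obtain ⟨rfl, rfl⟩ := List.cons_eq_cons.1 huv
      exact .letter a (ih u v rfl)
  | @call x z w₁ w₂ b hz h₁ h₂ ih₁ ih₂ =>
    cases u with
    -- Inserting in front of `b` does not nest `y` inside the word that begins with `b`: `y` becomes
    -- a separate call that precedes it.
    | nil => subst huv; exact insert_front (.call hz h₁ h₂) hy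
    | cons a' u =>
      obtain ⟨rfl, huv'⟩ := List.cons_eq_cons.1 huv
      rcases List.append_eq_append_iff.1 (show w₁ ++ w₂ = u ++ v from huv') with ⟨t, rfl, rfl⟩ | ⟨t, rfl, rfl⟩
      · simpa using Expansion.call hz h₁ (ih₂ t v rfl)
      · simpa using Expansion.call hz (ih₁ u t rfl) h₂

end Expansion

theorem InsertionClosure.expansion {α : Type*} {L : Language α} {w : List α}
    (h : InsertionClosure L w) : Expansion L [] w := by
  induction h with
  | nil => exact .nil
  | @insert u v x _ hx ih => exact ih.insert hx u v rfl

/-! ### The nesting machine: transitions and tape routines -/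

namespace AuxPDA

/-- States of the machine that runs nested copies of an automaton with states `Q`. The second
component of `sim` is the input symbol currently scanned by the active copy. -/
inductive NestState (Q α : Type)
  | init : NestState Q α
  | idle : NestState Q α
  | sim : Q → InputSymbol α → NestState Q α
  | walk : Bool → NestState Q α
  | rewind : Bool → NestState Q α
  | restore : NestState Q α

/-- Stack symbols of the machine that runs nested copies of an automaton. -/
inductive NestSymbol (Q α W Γ : Type)
  | sym : Γ → NestSymbol Q α W Γ
  | cell : W → NestSymbol Q α W Γ
  | tick : NestSymbol Q α W Γ
  | frame : Q → InputSymbol α → NestSymbol Q α W Γ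
  | base : NestSymbol Q α W Γ

instance {Q α : Type} [Finite Q] [Finite α] : Finite (NestState Q α) :=
  Finite.of_injective
    (fun s : NestState Q α => (match s with
      | .init => .inr (.inr 0)
      | .idle => .inr (.inr 1)
      | .sim q c => .inl (q, c)
      | .walk b => .inr (.inl (b, true))
      | .rewind b => .inr (.inl (b, false))
      | .restore => .inr (.inr 2) : (Q × InputSymbol α) ⊕ (Bool × Bool) ⊕ Fin 3))
    (by rintro (_ | _ | _ | _ | _ | _) (_ | _ | _ | _ | _ | _) h <;> simp_all)

instance {Q α W Γ : Type} [Finite Q] [Finite α] [Finite W] [Finite Γ] :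
    Finite (NestSymbol Q α W Γ) :=
  Finite.of_injective
    (fun s : NestSymbol Q α W Γ => (match s with
      | .sym x => .inl x
      | .cell x => .inr (.inl x)
      | .tick => .inr (.inr (.inl true))
      | .frame q c => .inr (.inr (.inr (q, c)))
      | .base => .inr (.inr (.inl false)) : Γ ⊕ W ⊕ Bool ⊕ (Q × InputSymbol α)))
    (by rintro (_ | _ | _ | _ | _) (_ | _ | _ | _ | _) h <;> simp_all)

/-- The topmost stack symbol as seen by the active copy. -/
def NestSymbol.view {Q α W Γ : Type} : Option (NestSymbol Q α W Γ) → Option Γ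
  | some (.sym x) => some x
  | _ => none

/-- A stack operation of the active copy, which cannot pop symbols of other kinds. -/
def NestSymbol.lift {Q α W Γ : Type} (g : Option (NestSymbol Q α W Γ)) :
    StackOp Γ → StackOp (NestSymbol Q α W Γ)
  | .keep => .keep
  | .push x => .push (.sym x)
  | .pop => match g with
    | some (.sym _) => .pop
    | _ => .keep

/-- How the scanned symbol of the active copy changes when it moves its head; at the end of the
letters read so far it either fetches the next letter of the actual input, or takes its own input
to be complete. -/
inductive NextSymbol {α β : Type*} (φ : β → α) :
    InputSymbol α → InputSymbol β → HeadMove → InputSymbol α → HeadMove → Prop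
  | stay (cur y) : NextSymbol φ cur y .stay cur .stay
  | atEnd (y) : NextSymbol φ .rightEnd y .right .rightEnd .stay
  | fetch (cur b) (h : cur ≠ .rightEnd) :
      NextSymbol φ cur (.letter b) .right (.letter (φ b)) .right
  | finish (a y) : NextSymbol φ (.letter a) y .right .rightEnd .stay

variable {α : Type} {β : Type*}

/-- The actions of the nesting machine while it simulates a copy of `K`. -/
inductive SimAction (K : AuxPDA α) (φ : β → α) (q : K.Q) (cur : InputSymbol α)
    (y : InputSymbol β) (x : Bool × Option K.W) (g : Option (NestSymbol K.Q α K.W K.Γ)) :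
    AuxPDAAction (NestState K.Q α) (Bool × Option K.W) (NestSymbol K.Q α K.W K.Γ) → Prop
  | sim (a) (ha : a ∈ K.trans q cur (x.2.getD K.blank) (NestSymbol.view g)) (cur' mv)
      (h : NextSymbol φ cur y a.inputMove cur' mv) :
      SimAction K φ q cur y x g
        ⟨.sim a.state cur', mv, (x.1, some a.write), a.workMove, NestSymbol.lift g a.stackOp⟩
  | call (h : cur ≠ .leftEnd) :
      SimAction K φ q cur y x g ⟨.walk true, .stay, x, .stay, .push (.frame q cur)⟩
  | ret (h : cur = .rightEnd) (hq : q ∈ K.accepting) :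
      SimAction K φ q cur y x g ⟨.walk false, .stay, x, .stay, .keep⟩

/-- Transitions of the nesting machine. -/
def nestTrans (K : AuxPDA α) (φ : β → α) : NestState K.Q α → InputSymbol β →
    Bool × Option K.W → Option (NestSymbol K.Q α K.W K.Γ) →
    Set (AuxPDAAction (NestState K.Q α) (Bool × Option K.W) (NestSymbol K.Q α K.W K.Γ))
  | .init, _, _, _ => {⟨.idle, .right, (true, none), .stay, .keep⟩}
  | .idle, _, x, _ => {⟨.sim K.start .leftEnd, .stay, x, .stay, .push .base⟩}
  | .sim q cur, y, x, g => {a | SimAction K φ q cur y x g a}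
  | .walk save, _, (b, some x), _ =>
    {⟨.walk save, .stay, (b, some x), .right, if save then .push .tick else .keep⟩}
  | .walk save, _, (b, none), _ => {⟨.rewind save, .stay, (b, none), .stay, .keep⟩}
  | .rewind save, _, (b, x), _ =>
    {⟨if b then if save then .sim K.start .leftEnd else .restore else .rewind save, .stay,
      (b, none), if b then .stay else .left,
      match save, x with
      | true, some x => .push (.cell x)
      | _, _ => .keep⟩}
  | .restore, _, x, some (.sym _) => {⟨.restore, .stay, x, .stay, .pop⟩}
  | .restore, _, x, some (.cell y) => {⟨.restore, .stay, (x.1, some y), .right, .pop⟩}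
  | .restore, _, x, some .tick => {⟨.restore, .stay, x, .left, .pop⟩}
  | .restore, _, x, some (.frame q cur) => {⟨.sim q cur, .stay, x, .stay, .pop⟩}
  | .restore, _, x, some .base => {⟨.idle, .stay, x, .stay, .pop⟩}
  | .restore, _, _, none => ∅

/-- The machine that runs nested copies of `K`, reading its input through `φ`. A copy may be
suspended by saving its work tape and state on the stack. -/
abbrev nest [Finite α] (K : AuxPDA α) (φ : β → α) : AuxPDA β where
  Q := NestState K.Q α
  W := Bool × Option K.W
  Γ := NestSymbol K.Q α K.W K.Γ
  finite_Q := by have := K.finite_Q; infer_instance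
  finite_W := by have := K.finite_W; infer_instance
  finite_Γ := by have := K.finite_Q; have := K.finite_W; have := K.finite_Γ; infer_instance
  start := .init
  accepting := {.idle}
  blank := (false, none)
  trans := nestTrans K φ

theorem nest_oneWay [Finite α] (K : AuxPDA α) (φ : β → α) : (nest K φ).OneWay := by
  rintro q x y t a ha
  change a ∈ nestTrans K φ q x y t at ha
  unfold nestTrans at ha
  split at ha
  case h_3 =>
    rcases ha with ⟨a, ha, cur', mv, h⟩ | _ | _
    · generalize a.inputMove = mv' at h
      cases h <;> simp
    · simp
    · simp
  case h_12 => exact ha.elim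
  all_goals
    rw [Set.mem_singleton_iff.1 ha]
    simp

/-- A tape whose first cell is marked and on which the first `m` cells have been visited. -/
def markedTape {V : Type*} (m : ℕ) (t : ℕ → V) (i : ℕ) : Bool × Option V :=
  (decide (i = 0), if i < m then some (t i) else none)

section markedTape

variable {V : Type*}

theorem markedTape_of_lt {m i : ℕ} (t : ℕ → V) (h : i < m) :
    markedTape m t i = (decide (i = 0), some (t i)) := by simp [markedTape, h]

theorem markedTape_of_le {m i : ℕ} (t : ℕ → V) (h : m ≤ i) :
    markedTape m t i = (decide (i = 0), none) := by simp [markedTape, h]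

theorem markedTape_zero_eq (t t' : ℕ → V) : markedTape 0 t = markedTape 0 t' := by
  funext i; simp [markedTape]

theorem update_markedTape_erase (m : ℕ) (t : ℕ → V) :
    Function.update (markedTape (m + 1) t) m (decide (m = 0), none) = markedTape m t := by
  funext i
  by_cases h : i = m
  · subst h; simp [markedTape]
  · simp only [markedTape, Function.update_of_ne h]
    have : i < m + 1 ↔ i < m := by omega
    simp [this]

theorem update_markedTape_extend (m : ℕ) (t : ℕ → V) :
    Function.update (markedTape m t) m (decide (m = 0), some (t m)) = markedTape (m + 1) t := by
  funext i
  by_cases h : i = m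
  · subst h; simp [markedTape]
  · simp only [markedTape, Function.update_of_ne h]
    have : i < m + 1 ↔ i < m := by omega
    simp [this]

/-- With `p ≤ m` the visited cells stay an initial segment, which grows by at most one cell. This is
why a head can recognize the end of that segment. -/
theorem update_markedTape_write {m p : ℕ} (t : ℕ → V) (x : V) (hp : p ≤ m) :
    Function.update (markedTape m t) p (decide (p = 0), some x) =
      markedTape (max m (p + 1)) (Function.update t p x) := by
  funext i
  by_cases h : i = p
  · subst h; simp [markedTape]
  · simp only [markedTape, Function.update_of_ne h]
    have : i < max m (p + 1) ↔ i < m := by omega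
    simp [this]

end markedTape

section loops

variable [Finite α] {K : AuxPDA α} {φ : β → α} {w : List β} {B h : ℕ} {t : ℕ → K.W}

/-- The first `none` marks the end of the visited part. The ticks record the distance to it, hence
the head position relative to that end. -/
theorem nest_walk (hh : h ≤ w.length + 1) (save : Bool) {m : ℕ} (hm : m < B) (d p : ℕ)
    (s : List (NestSymbol K.Q α K.W K.Γ)) (hd : p + d = m) :
    Run (nest K φ) w B (d + 1) ⟨.walk save, h, markedTape m t, p, s⟩
      ⟨.rewind save, h, markedTape m t, m,
        (if save then List.replicate d .tick else []) ++ s⟩ := by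
  induction d generalizing p s with
  | zero =>
    obtain rfl : p = m := hd
    have e := markedTape_of_le t (le_refl p)
    refine .of_stay (M := nest K φ) (.rewind save) (decide (p = 0), none) .stay .keep
      (markedTape p t) p _ (congrArg (nestTrans K φ (.walk save) _ · _) e)
      (e ▸ Function.update_eq_self _ _) rfl ?_ hh hm (by rintro ⟨⟩) (.refl _)
    cases save <;> rfl
  | succ d ih =>
    have e := markedTape_of_lt t (show p < m by omega)
    refine .of_stay (M := nest K φ) (.walk save) (decide (p = 0), some (t p)) .right
      (if save then .push .tick else .keep) (markedTape m t) (p + 1)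
      ((if save then [.tick] else []) ++ s) (congrArg (nestTrans K φ (.walk save) _ · _) e)
      (e ▸ Function.update_eq_self _ _) rfl (by cases save <;> rfl) hh (by omega)
      (by rintro ⟨⟩) ?_
    have e' : (if save then List.replicate d (.tick : NestSymbol K.Q α K.W K.Γ) else []) ++
        ((if save then [.tick] else []) ++ s) =
        (if save then List.replicate (d + 1) .tick else []) ++ s := by
      cases save <;> simp [List.replicate_succ']
    rw [← e']
    exact ih (p + 1) _ (by omega)

/-- The mark on cell 0 stops the pass to the left. Pushing cells in this direction leaves cell 0 on
top, so they can later be rewritten from left to right. -/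
theorem nest_rewind (hh : h ≤ w.length + 1) (save : Bool) (i : ℕ) (hi : i < B)
    (s : List (NestSymbol K.Q α K.W K.Γ)) :
    Run (nest K φ) w B (i + 1) ⟨.rewind save, h, markedTape (i + 1) t, i, s⟩
      ⟨if save then .sim K.start .leftEnd else .restore, h, markedTape 0 t, 0,
        (if save then (List.range (i + 1)).map (.cell ∘ t) else []) ++ s⟩ := by
  have e := markedTape_of_lt t (Nat.lt_succ_self i)
  induction i generalizing s with
  | zero =>
    refine .of_stay (M := nest K φ) (if save then .sim K.start .leftEnd else .restore)
      (decide (0 = 0), none) .stay (if save then .push (.cell (t 0)) else .keep)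
      (markedTape 0 t) 0 _ ((congrArg (nestTrans K φ (.rewind save) (inputAt w h) · s.head?) e).trans ?_)
      (update_markedTape_erase 0 t) rfl ?_ hh hi (by rintro ⟨⟩) (.refl _)
    · cases save <;> rfl
    · cases save <;> rfl
  | succ i ih =>
    refine .of_stay (M := nest K φ) (.rewind save)
      (decide (i + 1 = 0), none) .left (if save then .push (.cell (t (i + 1))) else .keep)
      (markedTape (i + 1) t) i ((if save then [.cell (t (i + 1))] else []) ++ s)
      ((congrArg (nestTrans K φ (.rewind save) (inputAt w h) · s.head?) e).trans ?_)
      (update_markedTape_erase _ t) rfl ?_ hh hi (by rintro ⟨⟩) ?_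
    · cases save <;> rfl
    · cases save <;> rfl
    · convert ih (by omega) ((if save then [.cell (t (i + 1))] else []) ++ s)
        (markedTape_of_lt t (Nat.lt_succ_self i)) using 2
      rw [List.range_succ (n := i + 1)]
      cases save <;> simp

/-- The pass starts on the unvisited cell `m`, for which nothing is pushed. If `m = 0` this is
already the marked cell. -/
theorem nest_rewind_from_end (hh : h ≤ w.length + 1) (save : Bool) (m : ℕ) (hm : m < B)
    (s : List (NestSymbol K.Q α K.W K.Γ)) :
    Run (nest K φ) w B (m + 1) ⟨.rewind save, h, markedTape m t, m, s⟩
      ⟨if save then .sim K.start .leftEnd else .restore, h, markedTape 0 t, 0,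
        (if save then (List.range m).map (.cell ∘ t) else []) ++ s⟩ := by
  have e := markedTape_of_le t (le_refl m)
  cases m with
  | zero =>
    refine .of_stay (M := nest K φ) (if save then .sim K.start .leftEnd else .restore)
      (decide (0 = 0), none) .stay .keep
      (markedTape 0 t) 0 _ ((congrArg (nestTrans K φ (.rewind save) (inputAt w h) · s.head?) e).trans ?_)
      (e ▸ Function.update_eq_self _ _) rfl ?_ hh hm (by rintro ⟨⟩) (.refl _)
    · cases save <;> rfl
    · cases save <;> rfl
  | succ i =>
    refine .of_stay (M := nest K φ) (.rewind save)
      (decide (i + 1 = 0), none) .left .keep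
      (markedTape (i + 1) t) i s ((congrArg (nestTrans K φ (.rewind save) (inputAt w h) · s.head?) e).trans ?_)
      (e ▸ Function.update_eq_self _ _) rfl rfl hh hm (by rintro ⟨⟩)
      (nest_rewind hh save i (by omega) s)
    cases save <;> rfl

theorem nest_restore_sym (hh : h ≤ w.length + 1) (hB : 0 < B) (g : List K.Γ)
    (s : List (NestSymbol K.Q α K.W K.Γ)) (T : ℕ → Bool × Option K.W) :
    Run (nest K φ) w B g.length ⟨.restore, h, T, 0, g.map .sym ++ s⟩ ⟨.restore, h, T, 0, s⟩ := by
  induction g with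
  | nil => exact .refl _
  | cons x g ih =>
    exact .of_stay (M := nest K φ) .restore (T 0) .stay .pop T 0 (g.map .sym ++ s) rfl
      (Function.update_eq_self _ _) rfl rfl hh hB (by rintro ⟨⟩) ih

theorem nest_restore_cell (hh : h ≤ w.length + 1) (d i : ℕ) (hB : i + d ≤ B)
    (s : List (NestSymbol K.Q α K.W K.Γ)) :
    Run (nest K φ) w B d ⟨.restore, h, markedTape i t, i, (List.range' i d).map (.cell ∘ t) ++ s⟩
      ⟨.restore, h, markedTape (i + d) t, i + d, s⟩ := by
  induction d generalizing i with
  | zero => exact .refl _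
  | succ d ih =>
    refine .of_stay (M := nest K φ) .restore (decide (i = 0), some (t i)) .right .pop
      (markedTape (i + 1) t) (i + 1) ((List.range' (i + 1) d).map (.cell ∘ t) ++ s) rfl
      (update_markedTape_extend _ _) rfl rfl hh (by omega) (by rintro ⟨⟩) ?_
    have e : i + (d + 1) = i + 1 + d := by omega
    rw [e]
    exact ih (i + 1) (by omega)

theorem nest_restore_tick (hh : h ≤ w.length + 1) (d p : ℕ) (hB : p + d < B)
    (s : List (NestSymbol K.Q α K.W K.Γ)) (T : ℕ → Bool × Option K.W) :
    Run (nest K φ) w B d ⟨.restore, h, T, p + d, List.replicate d .tick ++ s⟩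
      ⟨.restore, h, T, p, s⟩ := by
  induction d with
  | zero => exact .refl _
  | succ d ih =>
    exact .of_stay (M := nest K φ) .restore (T (p + (d + 1))) .left .pop T (p + d)
      (List.replicate d .tick ++ s) rfl (Function.update_eq_self _ _) rfl rfl hh hB
      (by rintro ⟨⟩) (ih (by omega))

/-- The stack contents that describe a suspended copy. -/
def savedFrame (q : K.Q) (cur : InputSymbol α) (m p : ℕ) (t : ℕ → K.W)
    (s : List (NestSymbol K.Q α K.W K.Γ)) : List (NestSymbol K.Q α K.W K.Γ) :=
  (List.range m).map (.cell ∘ t) ++ (List.replicate (m - p) .tick ++ .frame q cur :: s)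

theorem nest_suspend (hh : h ≤ w.length + 1) {m p : ℕ} (hp : p ≤ m) (hm : m < B) (q : K.Q)
    (cur : InputSymbol α) (s : List (NestSymbol K.Q α K.W K.Γ)) (t' : ℕ → K.W) :
    ∃ j ≤ 2 * B, Run (nest K φ) w B j ⟨.walk true, h, markedTape m t, p, .frame q cur :: s⟩
      ⟨.sim K.start .leftEnd, h, markedTape 0 t', 0, savedFrame q cur m p t s⟩ := by
  have h₁ := nest_walk (K := K) (φ := φ) (t := t) hh true hm (m - p) p (.frame q cur :: s) (by omega)
  have h₂ := h₁.trans (nest_rewind_from_end hh true m hm _)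
  -- An erased tape retains nothing of its former contents, so it also serves as the tape of the
  -- next active copy.
  rw [markedTape_zero_eq t t'] at h₂
  exact ⟨_, by omega, h₂⟩

theorem nest_discard (hh : h ≤ w.length + 1) {m p : ℕ} (hp : p ≤ m) (hm : m < B)
    (g : List K.Γ) (s : List (NestSymbol K.Q α K.W K.Γ)) (t' : ℕ → K.W) :
    ∃ j ≤ 2 * B + g.length, Run (nest K φ) w B j
      ⟨.walk false, h, markedTape m t, p, g.map .sym ++ s⟩
      ⟨.restore, h, markedTape 0 t', 0, s⟩ := by
  have h₁ := nest_walk (K := K) (φ := φ) (t := t) hh false hm (m - p) p (g.map .sym ++ s) (by omega)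
  have h₂ := h₁.trans (nest_rewind_from_end hh false m hm _)
  have h₃ := h₂.trans (nest_restore_sym hh (by omega) g s _)
  rw [markedTape_zero_eq t t'] at h₃
  exact ⟨_, by omega, h₃⟩

/-- The saved data come off the stack in the order in which they are needed: rewriting the cells
leaves the head at `m`, the ticks bring it back to `p`, and the frame symbol supplies state and
scanned symbol. -/
theorem nest_resume (hh : h ≤ w.length + 1) {m p : ℕ} (hp : p ≤ m) (hm : m < B) (q : K.Q)
    (cur : InputSymbol α) (s : List (NestSymbol K.Q α K.W K.Γ)) :
    ∃ j ≤ 2 * B, Run (nest K φ) w B j ⟨.restore, h, markedTape 0 t, 0, savedFrame q cur m p t s⟩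
      ⟨.sim q cur, h, markedTape m t, p, s⟩ := by
  have h₁ := nest_restore_cell (K := K) (φ := φ) (t := t) (B := B) hh m 0 (by omega)
    (List.replicate (m - p) .tick ++ .frame q cur :: s)
  rw [← List.range_eq_range', zero_add] at h₁
  have h₂ := nest_restore_tick (K := K) (φ := φ) hh (m - p) p (B := B) (by omega)
    (.frame q cur :: s) (markedTape m t)
  rw [Nat.add_sub_cancel' hp] at h₂
  have h₃ : Run (nest K φ) w B 1 ⟨.restore, h, markedTape m t, p, .frame q cur :: s⟩
      ⟨.sim q cur, h, markedTape m t, p, s⟩ := by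
    exact .of_stay (M := nest K φ) (.sim q cur) (markedTape m t p) .stay .pop (markedTape m t) p s
      rfl (Function.update_eq_self _ _) rfl rfl hh (by omega) (by rintro ⟨⟩) (.refl _)
  exact ⟨_, by omega, h₁.trans (h₂.trans h₃)⟩

theorem nest_resume_base (hh : h ≤ w.length + 1) (hB : 0 < B)
    (s : List (NestSymbol K.Q α K.W K.Γ)) (T : ℕ → Bool × Option K.W) :
    Run (nest K φ) w B 1 ⟨.restore, h, T, 0, .base :: s⟩ ⟨.idle, h, T, 0, s⟩ := by
  exact .of_stay (M := nest K φ) .idle (T 0) .stay .pop T 0 s rfl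
    (Function.update_eq_self _ _) rfl rfl hh hB (by rintro ⟨⟩) (.refl _)

end loops

end AuxPDA

/-! ### The nesting machine: invariant, soundness and resource bounds -/

namespace AuxPDA

variable {α : Type} {β : Type*}

/-- A copy of `K` together with the word that has been fed to it so far, the number of its steps,
the input symbol it scans and the number of work tape cells it has visited. -/
structure Frame (K : AuxPDA α) where
  word : List α
  steps : ℕ
  cur : InputSymbol α
  used : ℕ
  cfg : K.Config

/-- The copy of `K` reaches `c` in `j` steps after it has been fed `u`; if it does not know yet that
its input is complete, it does so on every continuation of `u`. -/
def Fed (K : AuxPDA α) (u : List α) (cur : InputSymbol α) (j : ℕ) (c : K.Config) : Prop :=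
  (cur = .rightEnd ∧ c.inputHead = u.length + 1 ∧ K.Reaches u j c) ∨
  (cur ≠ .rightEnd ∧ cur = inputAt u u.length ∧ c.inputHead = u.length ∧
    ∀ v, K.Reaches (u ++ v) j c)

/-- The empty continuation is allowed. Hence the bounds of `K` apply, in terms of `u`, to copies
that are unfinished or will never succeed. -/
theorem Fed.reaches {K : AuxPDA α} {u : List α} {cur : InputSymbol α} {j : ℕ} {c : K.Config}
    (h : Fed K u cur j c) : K.Reaches u j c := by
  rcases h with ⟨_, _, h⟩ | ⟨_, _, _, h⟩
  · exact h
  · simpa using h []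

/-- `1` as long as nothing has been fed to a copy. -/
def fresh : InputSymbol α → ℕ
  | .leftEnd => 1
  | _ => 0

theorem fresh_le_one (c : InputSymbol α) : fresh c ≤ 1 := by cases c <;> simp [fresh]

theorem fresh_eq_zero {c : InputSymbol α} (h : c ≠ .leftEnd) : fresh c = 0 := by
  cases c <;> simp_all [fresh]

/-- As long as the end of its input has not been declared, a copy has only seen `u`, so its step is
possible on every continuation. A fetch consumes the first letter of the continuation; declaring the
end selects the empty one. The last inequality says that a copy ceases to be fresh only by fetching
a letter, since the end can be declared only on a letter. -/
theorem Fed.next {K : AuxPDA α} {φ : β → α} {u : List α} {cur cur' : InputSymbol α} {j : ℕ}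
    {c : K.Config} (h : Fed K u cur j c) {a : AuxPDAAction K.Q K.W K.Γ}
    (ha : a ∈ K.trans c.state cur (c.workTape c.workHead) c.stack.head?) {z rest : List β}
    {mv : HeadMove}
    (hn : NextSymbol φ cur (inputAt (z ++ rest) (z.length + 1)) a.inputMove cur' mv) :
    ∃ e rest', rest = e ++ rest' ∧
      min (mv.apply (z.length + 1)) ((z ++ rest).length + 1) = (z ++ e).length + 1 ∧
      Fed K (u ++ e.map φ) cur' (j + 1) (K.perform (u ++ e.map φ) c a) ∧
      fresh cur ≤ e.length + fresh cur' := by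
  have hstep : ∀ v, cur = inputAt (u ++ v) c.inputHead → K.Reaches (u ++ v) j c →
      K.Reaches (u ++ v) (j + 1) (K.perform (u ++ v) c a) := fun v hv hr =>
    hr.step ⟨a, hv ▸ ha, rfl⟩
  generalize hmove : a.inputMove = move at hn
  generalize hy : inputAt (z ++ rest) (z.length + 1) = y at hn
  cases hn with
  | stay =>
    refine ⟨[], rest, rfl, by simp [HeadMove.apply], ?_, by simp⟩
    simp only [List.map_nil, List.append_nil]
    rcases h with ⟨hc, hh, hr⟩ | ⟨hc, hc', hh, hr⟩
    · refine .inl ⟨hc, by simp [perform, hmove, HeadMove.apply, hh], ?_⟩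
      simpa using hstep [] (by simp [hh, hc, inputAt_length_succ]) (by simpa using hr)
    · refine .inr ⟨hc, hc', by simp [perform, hmove, HeadMove.apply, hh], fun v => ?_⟩
      have := hstep v (by rw [hh, inputAt_append_of_le le_rfl, hc']) (hr v)
      -- The configurations differ only in the bound at which the input head is stopped, and neither
      -- bound is effective here.
      convert this using 1
      simp only [perform, hmove, HeadMove.apply, hh, List.length_append]
      congr 1; omega
  | atEnd =>
    refine ⟨[], rest, rfl, by simp [HeadMove.apply], ?_, by simp⟩
    simp only [List.map_nil, List.append_nil]
    rcases h with ⟨hc, hh, hr⟩ | ⟨hc, _⟩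
    · refine .inl ⟨hc, by simp [perform, hmove, HeadMove.apply, hh], ?_⟩
      simpa using hstep [] (by simp [hh, inputAt_length_succ]) (by simpa using hr)
    · exact absurd rfl hc
  | fetch _ b hcur =>
    obtain ⟨rest', rfl⟩ : ∃ rest', rest = b :: rest' := by
      cases rest with
      | nil => simp [inputAt] at hy
      | cons b' rest' =>
        rw [inputAt_append_cons] at hy
        cases hy; exact ⟨rest', rfl⟩
    refine ⟨[b], rest', rfl, by simp [HeadMove.apply], ?_, ?_⟩
    · rcases h with ⟨hc, _⟩ | ⟨hc, hc', hh, hr⟩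
      · exact absurd hc hcur
      · refine .inr ⟨by simp, ?_, by simp [perform, hmove, HeadMove.apply, hh], fun v => ?_⟩
        · simp [inputAt]
        · have := hstep ([φ b] ++ v) (by rw [hh, inputAt_append_of_le le_rfl, hc']) (hr _)
          simp only [List.map_cons, List.map_nil, List.append_assoc]
          convert this using 1
          simp [perform, hmove, HeadMove.apply, hh]
    · have := fresh_le_one cur
      simp; omega
  | finish x =>
    refine ⟨[], rest, rfl, by simp [HeadMove.apply], ?_, by simp [fresh]⟩
    simp only [List.map_nil, List.append_nil]
    rcases h with ⟨hc, _⟩ | ⟨hc, hc', hh, hr⟩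
    · cases hc
    · refine .inl ⟨rfl, by simp [perform, hmove, HeadMove.apply, hh], ?_⟩
      simpa using hstep [] (by rw [hh, inputAt_append_of_le le_rfl, hc']) (hr [])

theorem markedTape_getD {V : Type*} {m : ℕ} {t : ℕ → V} {b : V} (h : ∀ i, m ≤ i → t i = b) (p : ℕ) :
    (markedTape m t p).2.getD b = t p := by
  by_cases hp : p < m
  · simp [markedTape, hp]
  · simp [markedTape, hp, h p (by omega)]

theorem NestSymbol.view_append {Q W Γ : Type} (g : List Γ) {σ : List (NestSymbol Q α W Γ)}
    (h : view σ.head? = none) : view (g.map sym ++ σ).head? = g.head? := by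
  cases g with
  | nil => exact h
  | cons x g => rfl

theorem NestSymbol.lift_apply {Q W Γ : Type} (op : StackOp Γ) (g : List Γ)
    {σ : List (NestSymbol Q α W Γ)} (h : view σ.head? = none) :
    (lift (g.map sym ++ σ).head? op).apply (g.map sym ++ σ) = (op.apply g).map sym ++ σ := by
  cases op with
  | keep => rfl
  | push x => rfl
  | pop =>
    cases g with
    | cons x g => rfl
    | nil =>
      cases σ with
      | nil => rfl
      | cons y σ => cases y <;> simp_all [lift, StackOp.apply, view]

/-- The stack below the symbols of the active copy, given the suspended copies. -/
def nestContext {K : AuxPDA α} : List (Frame K) → List (NestSymbol K.Q α K.W K.Γ)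
  | [] => [.base]
  | f :: fs => savedFrame f.cfg.state f.cur f.used f.cfg.workHead f.cfg.workTape
      (f.cfg.stack.map .sym ++ nestContext fs)

/-- Below the symbols of the active copy there is always a symbol of another kind, so that copy sees
an empty stack there and cannot pop what is saved. -/
theorem view_nestContext {K : AuxPDA α} (fs : List (Frame K)) :
    NestSymbol.view (nestContext fs).head? = none := by
  cases fs with
  | nil => rfl
  | cons f fs =>
    simp only [nestContext, savedFrame]
    cases f.used with
    | zero => simp [NestSymbol.view]
    | succ m => simp [List.range_succ_eq_map, NestSymbol.view]

/-- The configuration of the nesting machine with the given nested copies, the active one first. -/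
def nestConfig [Finite α] {K : AuxPDA α} (φ : β → α) (h : ℕ) : List (Frame K) → (nest K φ).Config
  | [] => ⟨.idle, h, markedTape 0 (fun _ => K.blank), 0, []⟩
  | f :: fs => ⟨.sim f.cfg.state f.cur, h, markedTape f.used f.cfg.workTape, f.cfg.workHead,
      f.cfg.stack.map .sym ++ nestContext fs⟩

/-- A copy of `K` to which nothing has been fed. -/
def Frame.new (K : AuxPDA α) : Frame K := ⟨[], 0, .leftEnd, 0, K.initial⟩

/-- The copy after the action `a`, with `u` the word fed to it and `cur` the scanned symbol. -/
def Frame.next {K : AuxPDA α} (f : Frame K) (u : List α) (cur : InputSymbol α)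
    (a : AuxPDAAction K.Q K.W K.Γ) : Frame K :=
  ⟨u, f.steps + 1, cur, max f.used (f.cfg.workHead + 1), K.perform u f.cfg a⟩

/-- The data of a copy are consistent, and its tape content lies in the visited part. -/
structure Frame.Valid {K : AuxPDA α} (f : Frame K) : Prop where
  fed : Fed K f.word f.cur f.steps f.cfg
  blank : ∀ i, f.used ≤ i → f.cfg.workTape i = K.blank
  head_le : f.cfg.workHead ≤ f.used

theorem Frame.valid_new (K : AuxPDA α) : (Frame.new K).Valid where
  fed := .inr ⟨by simp [new], rfl, rfl, fun _ => .initial⟩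
  blank _ _ := rfl
  head_le := le_rfl

theorem Frame.Valid.next {K : AuxPDA α} {f : Frame K} (hf : f.Valid) {u : List α}
    {cur : InputSymbol α} {a : AuxPDAAction K.Q K.W K.Γ}
    (h : Fed K u cur (f.steps + 1) (K.perform u f.cfg a)) : (f.next u cur a).Valid where
  fed := h
  blank i hi := by
    simp only [Frame.next] at hi
    simp only [Frame.next, perform]
    rw [Function.update_of_ne (by omega)]
    exact hf.blank i (by omega)
  head_le := by
    simp only [Frame.next, perform]
    cases a.workMove <;> simp only [HeadMove.apply] <;> omega

section

variable {K : AuxPDA α} {φ : β → α}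

/-- The invariant of the nesting machine: `z` has been read, `fs` are the nested copies, `F` is the
number of finished copies and `m` the number of simulated steps. -/
structure NestInv (L : Language α) (φ : β → α) (P : ℕ) (z : List β) (fs : List (Frame K))
    (F m : ℕ) : Prop where
  valid : ∀ f ∈ fs, f.Valid
  word_le : ∀ f ∈ fs, f.word.length ≤ z.length
  not_fresh : ∀ f ∈ fs.tail, f.cur ≠ .leftEnd
  count : F + fs.length ≤ z.length + (fs.head?.map fun f => fresh f.cur).getD 0
  steps : m ≤ F * (P + 2) + (fs.map fun f => f.steps + 1).sum
  sound : ∀ vs, List.Forall₂ (fun (f : Frame K) v => f.word ++ v ∈ L) fs vs →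
    InsertionClosure L (z.map φ ++ vs.flatten)

/-- Each copy accounts for its call, at most `P` simulated steps and its return, hence `P + 2`. By
`count`, at most `z.length + 1` copies have been started, since only the active one can be fresh. -/
theorem NestInv.le {L : Language α} {P : ℕ} {z : List β} {fs : List (Frame K)} {F m : ℕ}
    (h : NestInv L φ P z fs F m) (hP : ∀ f ∈ fs, f.steps ≤ P) : m ≤ (z.length + 1) * (P + 2) := by
  have h₁ : (fs.map fun f => f.steps + 1).sum ≤ fs.length * (P + 2) := by
    rw [← smul_eq_mul, ← List.length_map (fun f : Frame K => f.steps + 1)]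
    refine List.sum_le_card_nsmul _ _ fun x hx => ?_
    obtain ⟨f, hf, rfl⟩ := List.mem_map.1 hx
    have := hP f hf; omega
  have h₂ : F + fs.length ≤ z.length + 1 := by
    have := h.count
    cases fs with
    | nil => simp at this ⊢; omega
    | cons f fs => have := fresh_le_one f.cur; simp_all; omega
  have h₃ := Nat.mul_le_mul_right (P + 2) h₂
  have h₄ := h.steps
  rw [add_mul] at h₃
  omega

/-- The new copy is paid for by its own freshness; the interrupted one is not fresh, so it is paid
for by a letter. For soundness, the completion of the new copy is a word of `L` inserted right after
what has been read. -/
theorem NestInv.call {L : Language α} {P : ℕ} {z : List β} {fs : List (Frame K)} {F m : ℕ}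
    (h : NestInv L φ P z fs F m) (hfs : ∀ f ∈ fs.head?, f.cur ≠ .leftEnd) :
    NestInv L φ P z (Frame.new K :: fs) F (m + 1) where
  valid := by simpa [Frame.valid_new] using h.valid
  word_le := by simpa [Frame.new] using h.word_le
  not_fresh := by
    cases fs with
    | nil => simp
    | cons f fs => simpa using ⟨hfs f (by simp), h.not_fresh⟩
  count := by
    have := h.count
    cases fs with
    | nil => simp at this; simp [Frame.new, fresh]; omega
    | cons f fs =>
      simp [fresh_eq_zero (hfs f (by simp))] at this
      simp [Frame.new, fresh]; omega
  steps := by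
    have := h.steps
    simp only [List.map_cons, List.sum_cons, Frame.new]; omega
  sound := by
    intro vs hvs
    cases hvs with
    | @cons _ v _ vs hv hvs =>
      have := (h.sound vs hvs).insert hv
      simpa [Frame.new] using this

theorem NestInv.ret {L : Language α} {P : ℕ} {z : List β} {f : Frame K} {fs : List (Frame K)}
    {F m : ℕ} (h : NestInv L φ P z (f :: fs) F m) (hP : f.steps ≤ P) (hcur : f.cur = .rightEnd)
    (hL : f.word ∈ L) : NestInv L φ P z fs (F + 1) (m + 1) where
  valid g hg := h.valid g (by simp [hg])
  word_le g hg := h.word_le g (by simp [hg])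
  not_fresh g hg := h.not_fresh g (List.mem_of_mem_tail hg)
  count := by
    have := h.count
    simp [hcur, fresh] at this; omega
  steps := by
    have := h.steps
    simp only [List.map_cons, List.sum_cons] at this
    rw [add_mul]; omega
  sound vs hvs := by
    have := h.sound ([] :: vs) (.cons (by simpa using hL) hvs)
    simpa using this

/-- A fetched letter moves from the pending completion `v` of the active copy to the word that has
been read; the concatenation considered in `sound` is the same. -/
theorem NestInv.next {L : Language α} {P : ℕ} {z e : List β} {f : Frame K} {fs : List (Frame K)}
    {F m : ℕ} (h : NestInv L φ P z (f :: fs) F m) {cur : InputSymbol α}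
    {a : AuxPDAAction K.Q K.W K.Γ}
    (hfed : Fed K (f.word ++ e.map φ) cur (f.steps + 1) (K.perform (f.word ++ e.map φ) f.cfg a))
    (hfresh : fresh f.cur ≤ e.length + fresh cur) :
    NestInv L φ P (z ++ e) (f.next (f.word ++ e.map φ) cur a :: fs) F (m + 1) where
  valid g hg := by
    rcases List.mem_cons.1 hg with rfl | hg
    · exact (h.valid f (by simp)).next hfed
    · exact h.valid g (by simp [hg])
  word_le g hg := by
    rcases List.mem_cons.1 hg with rfl | hg
    · have := h.word_le f (by simp)
      simpa [Frame.next] using this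
    · have := h.word_le g (by simp [hg])
      simp; omega
  not_fresh := h.not_fresh
  count := by
    have := h.count
    simp [Frame.next] at this ⊢; omega
  steps := by
    have := h.steps
    simp only [List.map_cons, List.sum_cons, Frame.next] at this ⊢; omega
  sound vs hvs := by
    cases hvs with
    | @cons _ v _ vs hv hvs =>
      have := h.sound ((e.map φ ++ v) :: vs) (.cons (by simpa [Frame.next] using hv) hvs)
      simpa using this

end

section

variable [Finite α] {K : AuxPDA α} {φ : β → α}

theorem nest_perform_sim (w : List β) (h : ℕ) {f : Frame K} (hf : f.Valid) (fs : List (Frame K))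
    (u : List α) (cur : InputSymbol α) (mv : HeadMove) (a : AuxPDAAction K.Q K.W K.Γ) :
    (nest K φ).perform w (nestConfig φ h (f :: fs)) ⟨.sim a.state cur, mv,
      ((markedTape f.used f.cfg.workTape f.cfg.workHead).1, some a.write), a.workMove,
      NestSymbol.lift (f.cfg.stack.map NestSymbol.sym ++ nestContext fs).head? a.stackOp⟩ =
    nestConfig φ (min (mv.apply h) (w.length + 1)) (f.next u cur a :: fs) := by
  simp only [perform, nestConfig, Frame.next, markedTape]
  congr 1
  · exact update_markedTape_write _ _ hf.head_le
  · exact NestSymbol.lift_apply _ _ (view_nestContext fs)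

theorem nest_mem_trans_sim {h : ℕ} {w : List β} {f : Frame K} (fs : List (Frame K))
    {a : AuxPDAAction (nest K φ).Q (nest K φ).W (nest K φ).Γ} :
    a ∈ (nest K φ).trans (nestConfig φ h (f :: fs)).state (inputAt w h)
      ((nestConfig φ h (f :: fs)).workTape (nestConfig φ h (f :: fs)).workHead)
      (nestConfig φ h (f :: fs)).stack.head? ↔
    SimAction K φ f.cfg.state f.cur (inputAt w h) (markedTape f.used f.cfg.workTape f.cfg.workHead)
      (f.cfg.stack.map NestSymbol.sym ++ nestContext fs).head? a := Iff.rfl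

theorem nest_run_call {w : List β} {h B : ℕ} (hh : h ≤ w.length + 1) {f : Frame K}
    (hf : f.Valid) (hB : f.used < B) (fs : List (Frame K)) :
    ∃ j ≤ 2 * B, Run (nest K φ) w B j
      ((nest K φ).perform w (nestConfig φ h (f :: fs)) ⟨.walk true, .stay,
        markedTape f.used f.cfg.workTape f.cfg.workHead, .stay, .push (.frame f.cfg.state f.cur)⟩)
      (nestConfig φ h (Frame.new K :: f :: fs)) := by
  obtain ⟨j, hj, hr⟩ := nest_suspend (φ := φ) hh hf.head_le hB f.cfg.state f.cur
    (f.cfg.stack.map .sym ++ nestContext fs) (t := f.cfg.workTape) (fun _ => K.blank)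
  refine ⟨j, hj, ?_⟩
  simpa [perform, nestConfig, nestContext, HeadMove.apply, StackOp.apply, Frame.new, initial, hh]
    using hr

theorem nest_run_return {w : List β} {h B P : ℕ} (hh : h ≤ w.length + 1) {f : Frame K}
    (hf : f.Valid) (hP : f.steps ≤ P) (fs : List (Frame K)) (hfs : ∀ g ∈ fs, g.Valid)
    (hB : ∀ g ∈ f :: fs, g.used < B) :
    ∃ j ≤ 4 * B + P + 1, Run (nest K φ) w B j
      ((nest K φ).perform w (nestConfig φ h (f :: fs)) ⟨.walk false, .stay,
        markedTape f.used f.cfg.workTape f.cfg.workHead, .stay, .keep⟩)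
      (nestConfig φ h fs) := by
  have hBf := hB f (by simp)
  have hlen := hf.fed.reaches.stack_length_le
  have hd := nest_discard (φ := φ) hh hf.head_le hBf f.cfg.stack (nestContext fs)
    (t := f.cfg.workTape)
  have e : (nest K φ).perform w (nestConfig φ h (f :: fs)) ⟨.walk false, .stay,
        markedTape f.used f.cfg.workTape f.cfg.workHead, .stay, .keep⟩ =
      ⟨.walk false, h, markedTape f.used f.cfg.workTape, f.cfg.workHead,
        f.cfg.stack.map .sym ++ nestContext fs⟩ := by
    simp [perform, nestConfig, HeadMove.apply, StackOp.apply, hh]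
  rw [e]
  cases fs with
  | nil =>
    obtain ⟨j, hj, hr⟩ := hd (fun _ => K.blank)
    exact ⟨_, by omega, hr.trans (nest_resume_base hh (by omega) _ _)⟩
  | cons g fs =>
    obtain ⟨j, hj, hr⟩ := hd g.cfg.workTape
    obtain ⟨j', hj', hr'⟩ := nest_resume (φ := φ) hh (hfs g (by simp)).head_le (hB g (by simp))
      g.cfg.state g.cur (g.cfg.stack.map .sym ++ nestContext fs) (t := g.cfg.workTape)
    exact ⟨_, by omega, hr.trans hr'⟩

theorem nest_bounds {L : Language α} (hL : K.accepts = L) {C : ℕ} {p : Polynomial ℕ}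
    (hC : ∀ (w : List α) (k : ℕ) (c : K.Config), K.Reaches w k c →
      c.workHead < C * (Nat.log 2 w.length + 1))
    (hp : ∀ (w : List α) (k : ℕ) (c : K.Config), K.Reaches w k c → k ≤ p.eval w.length)
    (w : List β) {k : ℕ} {c : (nest K φ).Config} (h : (nest K φ).Reaches w k c) :
    c.workHead < C * (Nat.log 2 w.length + 1) + 1 ∧
    k ≤ ((w.length + 1) * (p.eval w.length + 2) + 1) *
      (4 * (C * (Nat.log 2 w.length + 1) + 1) + p.eval w.length + 2) ∧
    (c.inputHead = w.length + 1 → c.state ∈ (nest K φ).accepting →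
      InsertionClosure L (w.map φ)) := by
  set B := C * (Nat.log 2 w.length + 1) + 1 with hBdef
  set P := p.eval w.length with hPdef
  -- The extra 1 leaves room for the cell under the head to become visited in the next step.
  have hhead : ∀ f : Frame K, f.Valid → f.word.length ≤ w.length → f.cfg.workHead + 1 < B := by
    intro f hf hw
    have h₁ := hC _ _ _ hf.fed.reaches
    have h₂ : C * (Nat.log 2 f.word.length + 1) ≤ C * (Nat.log 2 w.length + 1) :=
      Nat.mul_le_mul_left _ (Nat.succ_le_succ (Nat.log_mono_right hw))
    omega
  have hsteps : ∀ f : Frame K, f.Valid → f.word.length ≤ w.length → f.steps ≤ P :=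
    fun f hf hw => (hp _ _ _ hf.fed.reaches).trans (p.eval_nat_mono hw)
  let Main (m : ℕ) (c : (nest K φ).Config) : Prop := ∃ z rest fs F, w = z ++ rest ∧
    c = nestConfig φ (z.length + 1) fs ∧ NestInv L φ P z fs F m ∧ ∀ f ∈ fs, f.used < B
  -- The longest stretch is a return: clearing the tape and at most `P` stack symbols of the
  -- finished copy, then rebuilding the tape of the suspended one.
  have key := reaches_of_main (M := nest K φ) (w := w) (N := (w.length + 1) * (P + 2))
    (T := 4 * B + P + 1) (B := B) Main ?_ ?_ ?_ ?_ h
  · refine ⟨key.1, key.2.1, fun hend hacc => ?_⟩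
    obtain ⟨m, z, rest, fs, F, rfl, rfl, hinv, -⟩ := key.2.2 hacc
    cases fs with
    | cons f fs => cases hacc
    | nil =>
      have : rest = [] := by
        simp [nestConfig] at hend; exact hend
      subst this
      simpa using hinv.sound [] .nil
  · refine ⟨1, nestConfig φ 1 [], by omega, ?_, [], w, [], 0, by simp, rfl,
      ⟨by simp, by simp, by simp, by simp, by simp, ?_⟩, by simp⟩
    · refine .of_trans_eq (M := nest K φ) ⟨.idle, .right, (true, none), .stay, .keep⟩ rfl
        (by simp [initial]; omega) (by rintro ⟨⟩) ?_
      convert Run.refl (M := nest K φ) _ using 1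
      simp only [nestConfig, perform, HeadMove.apply, StackOp.apply, initial]
      congr 1
      · funext i
        by_cases hi : i = 0 <;> simp [markedTape, Function.update, hi]
    · intro vs hvs
      cases hvs
      exact .nil
  · rintro m c c₁ ⟨z, rest, fs, F, hw, rfl, hinv, hB⟩ ⟨a, ha, rfl⟩
    have hzw : z.length ≤ w.length := by simp [hw]
    have hh : z.length + 1 ≤ w.length + 1 := by omega
    cases fs with
    | nil =>
      obtain rfl := Set.mem_singleton_iff.1 ha
      refine ⟨0, nestConfig φ (z.length + 1) [Frame.new K], by omega, ?_,
        z, rest, _, F, hw, rfl, hinv.call (by simp), by simp [Frame.new, hBdef]⟩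
      convert Run.refl (M := nest K φ) _ using 1
      simp [nestConfig, perform, HeadMove.apply, StackOp.apply, Frame.new, initial, nestContext, hh]
    | cons f fs =>
      have hf := hinv.valid f (by simp)
      have hfw := (hinv.word_le f (by simp)).trans hzw
      rcases (nest_mem_trans_sim fs).1 ha with ⟨a, ha', cur, mv, hn⟩ | hc | ⟨hc, hq⟩
      · rw [markedTape_getD hf.blank, NestSymbol.view_append _ (view_nestContext fs)] at ha'
        subst hw
        obtain ⟨e, rest', rfl, hmin, hfed, hfresh⟩ := hf.fed.next ha' hn
        refine ⟨0, nestConfig φ ((z ++ e).length + 1) (f.next (f.word ++ e.map φ) cur a :: fs),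
          by omega, ?_, z ++ e, rest', _, F, by simp, rfl, hinv.next hfed hfresh, ?_⟩
        · rw [← hmin]
          convert Run.refl (M := nest K φ) _ using 1
          exact (nest_perform_sim _ _ hf fs _ cur mv a).symm
        · intro g hg
          rcases List.mem_cons.1 hg with rfl | hg
          · have := hhead f hf hfw
            have := hB f (by simp)
            simp only [Frame.next]; omega
          · exact hB g (by simp [hg])
      · obtain ⟨j, hj, hr⟩ := nest_run_call (φ := φ) hh hf (hB f (by simp)) fs
        exact ⟨j, _, by omega, hr, z, rest, _, F, hw, rfl, hinv.call (by simpa using hc),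
          List.forall_mem_cons.2 ⟨by simp [Frame.new, hBdef], hB⟩⟩
      · obtain ⟨j, hj, hr⟩ := nest_run_return (φ := φ) hh hf (hsteps f hf hfw) fs
          (fun g hg => hinv.valid g (by simp [hg])) hB
        have hL' : f.word ∈ L := by
          rw [← hL]
          rcases hf.fed with ⟨_, hh, hr⟩ | ⟨hne, _⟩
          · exact ⟨_, _, hr, hh, hq⟩
          · exact absurd hc hne
        exact ⟨j, _, by omega, hr, z, rest, fs, F + 1, hw, rfl,
          hinv.ret (hsteps f hf hfw) hc hL', fun g hg => hB g (by simp [hg])⟩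
  · rintro m c ⟨z, rest, fs, F, hw, rfl, hinv, hB⟩
    have hzw : z.length ≤ w.length := by simp [hw]
    refine (hinv.le fun f hf => hsteps f (hinv.valid f hf)
      ((hinv.word_le f hf).trans hzw)).trans ?_
    exact Nat.mul_le_mul_right _ (by omega)
  · rintro m c ⟨z, rest, fs, F, hw, rfl, hinv, hB⟩
    cases fs with
    | nil => simp [nestConfig]; omega
    | cons f fs => exact (hinv.valid f (by simp)).head_le.trans_lt (hB f (by simp))

end

end AuxPDA

/-! ### The nesting machine: completeness -/

namespace AuxPDA

open Relation

variable {α : Type} {β : Type*} {K : AuxPDA α} {φ : β → α}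

theorem NextSymbol.of_eq_stay (cur : InputSymbol α) (y : InputSymbol β) {mv : HeadMove}
    (h : mv = .stay) : NextSymbol φ cur y mv cur .stay := by
  subst h; exact .stay _ _

theorem NextSymbol.of_rightEnd (y : InputSymbol β) {mv : HeadMove} (h : mv ≠ .left) :
    NextSymbol φ .rightEnd y mv .rightEnd .stay := by
  cases mv with
  | left => exact absurd rfl h
  | stay => exact .stay _ _
  | right => exact .atEnd _

theorem Frame.Valid.inputAt_append {f : Frame K} (hf : f.Valid) (hcur : f.cur ≠ .rightEnd)
    (v : List α) : f.cfg.inputHead = f.word.length ∧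
      inputAt (f.word ++ v) f.cfg.inputHead = f.cur := by
  rcases hf.fed with ⟨h, _⟩ | ⟨_, hc, hh, _⟩
  · exact absurd h hcur
  · exact ⟨hh, by rw [hh, inputAt_append_of_le le_rfl, hc]⟩

theorem Frame.Valid.next_stay (φ : β → α) {f : Frame K} (hf : f.Valid)
    {a : AuxPDAAction K.Q K.W K.Γ}
    (ha : a ∈ K.trans f.cfg.state f.cur (f.cfg.workTape f.cfg.workHead) f.cfg.stack.head?)
    (hm : a.inputMove = .stay) : (f.next f.word f.cur a).Valid := by
  obtain ⟨e, rest', he, -, hfed, -⟩ := hf.fed.next (φ := φ) (z := []) (rest := []) ha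
    (.of_eq_stay _ _ hm)
  obtain ⟨rfl, rfl⟩ := List.append_eq_nil_iff.1 he.symm
  simp only [List.map_nil, List.append_nil] at hfed
  exact hf.next hfed

variable [Finite α]

theorem nest_step_sim {w : List β} {h : ℕ} {f : Frame K} (hf : f.Valid) (fs : List (Frame K))
    (u : List α) {cur : InputSymbol α} {mv : HeadMove} {a : AuxPDAAction K.Q K.W K.Γ}
    (ha : a ∈ K.trans f.cfg.state f.cur (f.cfg.workTape f.cfg.workHead) f.cfg.stack.head?)
    (hn : NextSymbol φ f.cur (inputAt w h) a.inputMove cur mv) :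
    (nest K φ).Step w (nestConfig φ h (f :: fs))
      (nestConfig φ (min (mv.apply h) (w.length + 1)) (f.next u cur a :: fs)) := by
  refine ⟨_, ?_, (nest_perform_sim w h hf fs u cur mv a).symm⟩
  refine (nest_mem_trans_sim fs).2 (.sim a ?_ cur mv hn)
  rwa [markedTape_getD hf.blank, NestSymbol.view_append _ (view_nestContext fs)]

theorem nest_reaches_call {w : List β} {h : ℕ} (hh : h ≤ w.length + 1) {fs : List (Frame K)}
    (hfs : ∀ f ∈ fs, f.Valid) (hcur : ∀ f ∈ fs.head?, f.cur ≠ .leftEnd) :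
    ReflTransGen ((nest K φ).Step w) (nestConfig φ h fs) (nestConfig φ h (Frame.new K :: fs)) := by
  cases fs with
  | nil =>
    refine .single ⟨_, rfl, ?_⟩
    simp [nestConfig, perform, HeadMove.apply, StackOp.apply, Frame.new, initial, nestContext, hh]
  | cons f fs =>
    obtain ⟨j, -, hr⟩ := nest_run_call (φ := φ) hh (hfs f (by simp)) (Nat.lt_succ_self _) fs
    exact .head ⟨_, (nest_mem_trans_sim fs).2 (.call (hcur f (by simp))), rfl⟩ hr.reflTransGen

theorem nest_reaches_return {w : List β} {h : ℕ} (hh : h ≤ w.length + 1) {f : Frame K}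
    {fs : List (Frame K)} (hf : f.Valid) (hfs : ∀ f ∈ fs, f.Valid) (hcur : f.cur = .rightEnd)
    (hq : f.cfg.state ∈ K.accepting) :
    ReflTransGen ((nest K φ).Step w) (nestConfig φ h (f :: fs)) (nestConfig φ h fs) := by
  -- Only reachability matters here, so any bound above all the `used` values will do.
  obtain ⟨j, -, hr⟩ := nest_run_return (φ := φ) (B := ((f :: fs).map Frame.used).sum + 1) hh hf
    le_rfl fs hfs
    (fun g hg => Nat.lt_succ_of_le (List.le_sum_of_mem (List.mem_map_of_mem hg)))
  exact .head ⟨_, (nest_mem_trans_sim fs).2 (.ret hcur hq), rfl⟩ hr.reflTransGen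

theorem nest_reaches_end (hK : K.OneWay) {w : List β} {h : ℕ} (hh : h ≤ w.length + 1)
    (fs : List (Frame K)) {u : List α} {c d : K.Config} (hcd : ReflTransGen (K.Step u) c d)
    {f : Frame K} (hf : f.Valid) (hcur : f.cur = .rightEnd) (hu : f.word = u) (hc : f.cfg = c) :
    ∃ f' : Frame K, f'.Valid ∧ f'.cur = .rightEnd ∧ f'.cfg = d ∧
      ReflTransGen ((nest K φ).Step w) (nestConfig φ h (f :: fs)) (nestConfig φ h (f' :: fs)) := by
  induction hcd using ReflTransGen.head_induction_on generalizing f with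
  | refl => exact ⟨f, hf, hcur, hc, .refl⟩
  | @head c c' hs _ ih =>
    subst hu hc
    obtain ⟨a, ha, rfl⟩ := hs
    have hin : inputAt f.word f.cfg.inputHead = f.cur := by
      rcases hf.fed with ⟨_, hh, _⟩ | ⟨hne, _⟩
      · rw [hh, inputAt_length_succ, hcur]
      · exact absurd hcur hne
    rw [hin] at ha
    have hn : ∀ y, NextSymbol φ f.cur y a.inputMove .rightEnd .stay := fun y => by
      rw [hcur]; exact .of_rightEnd y (hK _ _ _ _ a ha)
    obtain ⟨e, rest', he, -, hfed, -⟩ := hf.fed.next (z := []) (rest := []) ha (hn _)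
    obtain ⟨rfl, rfl⟩ := List.append_eq_nil_iff.1 he.symm
    simp only [List.map_nil, List.append_nil] at hfed
    obtain ⟨f', h₁, h₂, h₃, h₄⟩ := ih (hf.next hfed) rfl rfl rfl
    refine ⟨f', h₁, h₂, h₃, .head ?_ h₄⟩
    simpa [HeadMove.apply, hh] using nest_step_sim (w := w) (h := h) hf fs f.word ha (hn _)

/-- The given computation of `K` ends on the right end marker, so at some moment it moves right from
the last letter. That is when the copy declares its input complete; the rest is `nest_reaches_end`.
-/
theorem nest_reaches_finish (hK : K.OneWay) {w : List β} {h : ℕ} (hh : h ≤ w.length + 1)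
    (fs : List (Frame K)) {u : List α} {c d : K.Config} (hcd : ReflTransGen (K.Step u) c d)
    (hd : d.inputHead = u.length + 1) {f : Frame K} (hf : f.Valid) {x : α}
    (hcur : f.cur = .letter x) (hu : f.word = u) (hc : f.cfg = c) :
    ∃ f' : Frame K, f'.Valid ∧ f'.cur = .rightEnd ∧ f'.cfg = d ∧
      ReflTransGen ((nest K φ).Step w) (nestConfig φ h (f :: fs)) (nestConfig φ h (f' :: fs)) := by
  induction hcd using ReflTransGen.head_induction_on generalizing f with
  | refl =>
    subst hu hc
    have := (hf.inputAt_append (by simp [hcur]) []).1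
    omega
  | @head c c' hs hcd ih =>
    subst hu hc
    obtain ⟨a, ha, rfl⟩ := hs
    have hin := (hf.inputAt_append (by simp [hcur]) []).2
    rw [List.append_nil] at hin
    rw [hin] at ha
    cases hm : a.inputMove with
    | left => exact absurd hm (hK _ _ _ _ a ha)
    | stay =>
      obtain ⟨f', h₁, h₂, h₃, h₄⟩ := ih (hf.next_stay φ ha hm) hcur rfl rfl
      refine ⟨f', h₁, h₂, h₃, .head ?_ h₄⟩
      simpa [HeadMove.apply, hh] using
        nest_step_sim (w := w) (h := h) hf fs f.word ha (.of_eq_stay _ _ hm)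
    | right =>
      have hn : ∀ y, NextSymbol φ f.cur y a.inputMove .rightEnd .stay := fun y => by
        rw [hm, hcur]; exact .finish _ _
      obtain ⟨e, rest', he, -, hfed, -⟩ := hf.fed.next (z := []) (rest := []) ha (hn _)
      obtain ⟨rfl, rfl⟩ := List.append_eq_nil_iff.1 he.symm
      simp only [List.map_nil, List.append_nil] at hfed
      obtain ⟨f', h₁, h₂, h₃, h₄⟩ := nest_reaches_end (φ := φ) (w := w) (h := h) hK hh fs hcd
        (hf.next hfed) rfl rfl rfl
      refine ⟨f', h₁, h₂, h₃, .head ?_ h₄⟩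
      simpa [HeadMove.apply, hh] using nest_step_sim (w := w) (h := h) hf fs f.word ha (hn _)

/-- Follow the computation of `K` until it first moves right. It must do so, as it ends on the right
end marker, and until then it does not depend on the letters beyond `u`. -/
theorem nest_reaches_fetch (hK : K.OneWay) {z rest : List β} {b : β} (fs : List (Frame K))
    {u v : List α} {c d : K.Config}
    (hcd : ReflTransGen (K.Step (u ++ φ b :: v)) c d)
    (hd : d.inputHead = (u ++ φ b :: v).length + 1) {f : Frame K} (hf : f.Valid)
    (hcur : f.cur ≠ .rightEnd) (hu : f.word = u) (hc : f.cfg = c) :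
    ∃ f' : Frame K, f'.Valid ∧ f'.cur = .letter (φ b) ∧ f'.word = u ++ [φ b] ∧
      ReflTransGen (K.Step (u ++ φ b :: v)) f'.cfg d ∧
      ReflTransGen ((nest K φ).Step (z ++ b :: rest)) (nestConfig φ (z.length + 1) (f :: fs))
        (nestConfig φ ((z ++ [b]).length + 1) (f' :: fs)) := by
  induction hcd using ReflTransGen.head_induction_on generalizing f with
  | refl =>
    subst hu hc
    have := (hf.inputAt_append hcur []).1
    simp at hd; omega
  | @head c c' hs hcd ih =>
    subst hu hc
    obtain ⟨a, ha, rfl⟩ := hs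
    obtain ⟨hhead, hin⟩ := hf.inputAt_append hcur (φ b :: v)
    rw [hin] at ha
    cases hm : a.inputMove with
    | left => exact absurd hm (hK _ _ _ _ a ha)
    | stay =>
      have e : K.perform (f.word ++ φ b :: v) f.cfg a = K.perform f.word f.cfg a := by
        simp only [perform, hm, HeadMove.apply, hhead, List.length_append]
        congr 1; omega
      obtain ⟨f', h₁, h₂, h₃, h₄, h₅⟩ := ih (hf.next_stay φ ha hm) hcur rfl e.symm
      refine ⟨f', h₁, h₂, h₃, h₄, .head ?_ h₅⟩
      simpa [HeadMove.apply] using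
        nest_step_sim (w := z ++ b :: rest) (h := z.length + 1) hf fs f.word ha
          (.of_eq_stay _ _ hm)
    | right =>
      have hn : NextSymbol φ f.cur (inputAt (z ++ b :: rest) (z.length + 1)) a.inputMove
          (.letter (φ b)) .right := by
        rw [hm, inputAt_append_cons]; exact .fetch _ _ hcur
      obtain ⟨e, rest', he, hmin, hfed, -⟩ := hf.fed.next ha hn
      obtain rfl : e = [b] := by
        simp only [HeadMove.apply, List.length_append, List.length_cons] at hmin
        match e, he with
        | [], _ => simp at hmin
        | [b'], he => simp at he; rw [he.1]
        | b' :: b'' :: e, he => simp at hmin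
      refine ⟨_, hf.next hfed, rfl, rfl, ?_, .single ?_⟩
      · convert hcd using 1
        simp only [Frame.next, perform, hm, HeadMove.apply, hhead]
        simp
      · rw [← hmin]
        exact nest_step_sim hf fs _ ha hn

/-- Induction on the expansion: own letters are fetched, an inserted word is handled by a call, the
fetch of its first letter, the induction hypothesis for its remainder, and a return. The active copy
scans a letter, so calls are allowed. -/
theorem nest_reaches_expansion (hK : K.OneWay) {L : Language α} (hL : K.accepts = L)
    {x w : List α} (hx : Expansion L x w) (y z rest : List β) (hy : y.map φ = w)
    {fs : List (Frame K)} (hfs : ∀ g ∈ fs, g.Valid) {d : K.Config} {f : Frame K} (hf : f.Valid)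
    {b : α} (hcur : f.cur = .letter b) (hcd : ReflTransGen (K.Step (f.word ++ x)) f.cfg d)
    (hd : d.inputHead = (f.word ++ x).length + 1) :
    ∃ f' : Frame K, f'.Valid ∧ f'.cur = .rightEnd ∧ f'.cfg = d ∧
      ReflTransGen ((nest K φ).Step (z ++ y ++ rest)) (nestConfig φ (z.length + 1) (f :: fs))
        (nestConfig φ ((z ++ y).length + 1) (f' :: fs)) := by
  induction hx generalizing y z rest fs d f b with
  | nil =>
    obtain rfl := List.map_eq_nil_iff.1 hy
    rw [List.append_nil] at hcd hd
    obtain ⟨f', h₁, h₂, h₃, h₄⟩ := nest_reaches_finish (φ := φ) (w := z ++ rest)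
      (h := z.length + 1) hK (by simp) fs hcd hd hf hcur rfl rfl
    exact ⟨f', h₁, h₂, h₃, by simpa using h₄⟩
  | @letter x w a _ ih =>
    obtain ⟨a, y, rfl, rfl, rfl⟩ := List.map_eq_cons_iff.1 hy
    obtain ⟨f₁, h₁, h₂, h₃, h₄, h₅⟩ := nest_reaches_fetch (z := z) (rest := y ++ rest) hK fs hcd hd
      hf (by simp [hcur]) rfl rfl
    have e : f.word ++ φ a :: x = f₁.word ++ x := by simp [h₃]
    rw [e] at h₄ hd
    obtain ⟨f', g₁, g₂, g₃, g₄⟩ := ih y (z ++ [a]) rest rfl hfs h₁ h₂ h₄ hd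
    simp only [List.append_assoc, List.cons_append, List.nil_append] at h₅ g₄ ⊢
    exact ⟨f', g₁, g₂, g₃, h₅.trans g₄⟩
  | @call x v w₁ w₂ b' hv _ _ ih₁ ih₂ =>
    obtain ⟨y', y₂, rfl, hy', rfl⟩ := List.map_eq_append_iff.1 hy
    obtain ⟨c, y₁, rfl, rfl, rfl⟩ := List.map_eq_cons_iff.1 hy'
    rw [← hL] at hv
    obtain ⟨d', hd', hend, hacc⟩ := mem_accepts_iff.1 hv
    have hfs' : ∀ g ∈ f :: fs, g.Valid := List.forall_mem_cons.2 ⟨hf, hfs⟩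
    have s₁ := nest_reaches_call (φ := φ) (w := z ++ (c :: y₁ ++ y₂) ++ rest) (h := z.length + 1)
      (by simp) hfs' (by simp [hcur])
    obtain ⟨f₁, h₁, h₂, h₃, h₄, s₂⟩ := nest_reaches_fetch (z := z) (rest := y₁ ++ (y₂ ++ rest))
      (u := []) (v := v) hK (f :: fs) hd' hend (Frame.valid_new K) (by simp [Frame.new]) rfl rfl
    have e : [] ++ φ c :: v = f₁.word ++ v := by simp [h₃]
    rw [e] at h₄
    obtain ⟨f₂, k₁, k₂, rfl, s₃⟩ := ih₁ y₁ (z ++ [c]) (y₂ ++ rest) rfl hfs' h₁ h₂ h₄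
      (by rw [← e]; exact hend)
    have s₄ := nest_reaches_return (φ := φ) (w := z ++ (c :: y₁ ++ y₂) ++ rest)
      (h := (z ++ [c] ++ y₁).length + 1) (by simp) k₁ hfs' k₂ hacc
    obtain ⟨f', l₁, l₂, l₃, s₅⟩ := ih₂ y₂ (z ++ [c] ++ y₁) rest rfl hfs hf hcur hcd hd
    simp only [List.append_assoc, List.cons_append, List.nil_append] at s₁ s₂ s₃ s₄ s₅ ⊢
    exact ⟨f', l₁, l₂, l₃, s₁.trans (s₂.trans (s₃.trans (s₄.trans s₅)))⟩

/-- The outermost level has no copy and hence no letters of its own, so the expansion is a sequence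
of calls from the idle state. -/
theorem nest_reaches_idle (hK : K.OneWay) {L : Language α} (hL : K.accepts = L)
    {x w : List α} (hx : Expansion L x w) (hx' : x = []) (y z rest : List β) (hy : y.map φ = w) :
    ReflTransGen ((nest K φ).Step (z ++ y ++ rest)) (nestConfig φ (z.length + 1) [])
      (nestConfig φ ((z ++ y).length + 1) []) := by
  induction hx generalizing y z rest with
  | nil =>
    obtain rfl := List.map_eq_nil_iff.1 hy
    simpa using .refl
  | letter => cases hx'
  | @call x v w₁ w₂ b' hv hv₁ _ _ ih₂ =>
    obtain ⟨y', y₂, rfl, hy', rfl⟩ := List.map_eq_append_iff.1 hy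
    obtain ⟨c, y₁, rfl, rfl, rfl⟩ := List.map_eq_cons_iff.1 hy'
    have hv' := hv
    rw [← hL] at hv
    obtain ⟨d', hd', hend, hacc⟩ := mem_accepts_iff.1 hv
    have s₁ := nest_reaches_call (K := K) (φ := φ) (w := z ++ (c :: y₁ ++ y₂) ++ rest)
      (h := z.length + 1) (fs := []) (by simp) (by simp) (by simp)
    obtain ⟨f₁, h₁, h₂, h₃, h₄, s₂⟩ := nest_reaches_fetch (z := z) (rest := y₁ ++ (y₂ ++ rest))
      (u := []) (v := v) hK [] hd' hend (Frame.valid_new K) (by simp [Frame.new]) rfl rfl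
    have e : [] ++ φ c :: v = f₁.word ++ v := by simp [h₃]
    rw [e] at h₄
    obtain ⟨f₂, k₁, k₂, rfl, s₃⟩ := nest_reaches_expansion hK hL hv₁ y₁ (z ++ [c]) (y₂ ++ rest) rfl
      (fs := []) (by simp) h₁ h₂ h₄ (by rw [← e]; exact hend)
    have s₄ := nest_reaches_return (φ := φ) (w := z ++ (c :: y₁ ++ y₂) ++ rest)
      (h := (z ++ [c] ++ y₁).length + 1) (fs := []) (by simp) k₁ (by simp) k₂ hacc
    have s₅ := ih₂ hx' y₂ (z ++ [c] ++ y₁) rest rfl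
    simp only [List.append_assoc, List.cons_append, List.nil_append] at s₁ s₂ s₃ s₄ s₅ ⊢
    exact s₁.trans (s₂.trans (s₃.trans (s₄.trans s₅)))

theorem nest_accepts (hK : K.OneWay) {L : Language α} (hL : K.accepts = L) {w : List β}
    (hw : InsertionClosure L (w.map φ)) : w ∈ (nest K φ).accepts := by
  rw [mem_accepts_iff]
  refine ⟨nestConfig φ (w.length + 1) [], .head ⟨_, rfl, rfl⟩ ?_, rfl, rfl⟩
  have h := nest_reaches_idle hK hL hw.expansion rfl w [] [] rfl
  rw [List.nil_append, List.append_nil] at h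
  convert h using 1
  simp only [nestConfig, perform, HeadMove.apply, StackOp.apply, initial]
  congr 1
  · funext i
    by_cases hi : i = 0 <;> simp [markedTape, Function.update, hi]

end AuxPDA

/-- The words whose image under `φ` lies in the insertion closure of a recognized language form a
recognized language. -/
theorem RecognizedByOneWayAuxPDA.insertionClosure {α : Type} [Finite α] {β : Type*}
    {L : Language α} (hL : RecognizedByOneWayAuxPDA L) (φ : β → α) :
    RecognizedByOneWayAuxPDA ({w | InsertionClosure L (w.map φ)} : Language β) := by
  obtain ⟨K, hK, ⟨C, hC⟩, ⟨p, hp⟩, hacc⟩ := hL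
  -- The one cell beyond the bound of `K` is absorbed by increasing the constant by 1.
  refine ⟨AuxPDA.nest K φ, AuxPDA.nest_oneWay K φ, ⟨C + 1, fun w k c h => ?_⟩,
    ⟨((.X + 1) * (p + 2) + 1) * (4 * (.C C * (.X + 1) + 1) + p + 2), fun w k c h => ?_⟩, ?_⟩
  · have := (AuxPDA.nest_bounds hacc hC hp w h).1
    rw [add_mul]; omega
  · refine (AuxPDA.nest_bounds hacc hC hp w h).2.1.trans ?_
    have hlog : Nat.log 2 w.length ≤ w.length := Nat.log_le_self _ _
    simp only [Polynomial.eval_mul, Polynomial.eval_add, Polynomial.eval_X, Polynomial.eval_C,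
      Polynomial.eval_one, Polynomial.eval_ofNat]
    gcongr
  · ext w
    constructor
    · rintro ⟨k, c, h, hend, hq⟩
      exact (AuxPDA.nest_bounds hacc hC hp w h).2.2 hend hq
    · exact AuxPDA.nest_accepts hK hacc

/-! ### Finite unions and change of alphabet -/

namespace AuxPDA

section union

variable {ι : Type} {α : ι → Type*} {β : Type*}

/-- An input symbol of one machine seen as an input symbol of another one, along a partial map
between the alphabets. -/
inductive SymbolRel {α β : Type*} (f : β → Option α) : InputSymbol β → InputSymbol α → Prop
  | leftEnd : SymbolRel f .leftEnd .leftEnd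
  | letter {b : β} {a : α} (h : f b = some a) : SymbolRel f (.letter b) (.letter a)
  | rightEnd : SymbolRel f .rightEnd .rightEnd

/-- Renaming of stack symbols in a stack operation. -/
def mapStackOp {Γ Δ : Type*} (f : Γ → Δ) : StackOp Γ → StackOp Δ
  | .keep => .keep
  | .pop => .pop
  | .push x => .push (f x)

theorem mapStackOp_apply {Γ Δ : Type*} (f : Γ → Δ) (op : StackOp Γ) (s : List Γ) :
    (mapStackOp f op).apply (s.map f) = (op.apply s).map f := by
  cases op <;> simp [mapStackOp, StackOp.apply]

open Classical in
/-- Transitions of the machine that runs one of the machines `M i`. -/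
def unionTrans (M : ∀ i, AuxPDA (α i)) (f : ∀ i, β → Option (α i)) :
    Option (Σ i, (M i).Q) → InputSymbol β → (∀ i, (M i).W) → Option (Σ i, (M i).Γ) →
    Set (AuxPDAAction (Option (Σ i, (M i).Q)) (∀ i, (M i).W) (Σ i, (M i).Γ))
  | none, _, x, _ => {a | ∃ i, a = ⟨some ⟨i, (M i).start⟩, .stay, x, .stay, .keep⟩}
  | some ⟨i, q⟩, y, x, g => {a | ∃ y' g', ∃ a' ∈ (M i).trans q y' (x i) g',
      SymbolRel (f i) y y' ∧ g = g'.map (Sigma.mk i) ∧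
      a = ⟨some ⟨i, a'.state⟩, a'.inputMove, Function.update x i a'.write, a'.workMove,
        mapStackOp (Sigma.mk i) a'.stackOp⟩}

/-- The machine that chooses one of the machines `M i` and runs it, reading its input through the
partial map `f i`. -/
abbrev union [Finite ι] (M : ∀ i, AuxPDA (α i)) (f : ∀ i, β → Option (α i)) : AuxPDA β where
  Q := Option (Σ i, (M i).Q)
  W := ∀ i, (M i).W
  Γ := Σ i, (M i).Γ
  finite_Q := by have := fun i => (M i).finite_Q; infer_instance
  finite_W := by have := fun i => (M i).finite_W; infer_instance
  finite_Γ := by have := fun i => (M i).finite_Γ; infer_instance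
  start := none
  accepting := {q | ∃ i, ∃ q' ∈ (M i).accepting, q = some ⟨i, q'⟩}
  blank := fun i => (M i).blank
  trans := unionTrans M f

theorem Reaches.inputHead_le {α : Type*} {M : AuxPDA α} {w : List α} {k : ℕ} {c : M.Config}
    (h : M.Reaches w k c) : c.inputHead ≤ w.length + 1 := by
  cases h with
  | initial => simp [AuxPDA.initial]
  | step _ hs => obtain ⟨a, _, rfl⟩ := hs; exact min_le_right _ _

theorem exists_maximal_prefix {α β : Type*} (f : β → Option α) (w : List β) :
    ∃ (u : List α) (r : List (Option α)), w.map f = u.map some ++ r ∧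
      ∀ o ∈ r.head?, o = none := by
  induction w with
  | nil => exact ⟨[], [], rfl, by simp⟩
  | cons b w ih =>
    obtain ⟨u, r, h, hr⟩ := ih
    cases hb : f b with
    | none => exact ⟨[], _, rfl, by simp [hb]⟩
    | some a => exact ⟨a :: u, r, by simp [hb, h], hr⟩

theorem map_sigmaMk_head?_eq {σ : ι → Type*} {i : ι} {s : List (σ i)} {g : Option (σ i)}
    (h : (s.map (Sigma.mk i)).head? = g.map (Sigma.mk i)) : s.head? = g := by
  rw [List.head?_map] at h
  exact Option.map_injective sigma_mk_injective h

/-- The first letter outside the domain of `f` blocks the simulation, so the simulated machine never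
notices that its input was not the whole of `w`. The last alternative ensures that stopping the head
at the right end has the same effect on both inputs. -/
theorem SymbolRel.eq_inputAt {α β : Type*} {f : β → Option α} {w : List β} {u : List α}
    {r : List (Option α)} (h : w.map f = u.map some ++ r) (hr : ∀ o ∈ r.head?, o = none) {p : ℕ}
    (hp : p ≤ u.length + 1) {y : InputSymbol α} (hy : SymbolRel f (inputAt w p) y) :
    y = inputAt u p ∧ (p ≤ u.length ∨ w.length = u.length) := by
  cases p with
  | zero => simp only [inputAt] at hy ⊢; cases hy; simp
  | succ p =>
    have hget : w[p]?.map f = (u.map some ++ r)[p]? := by rw [← h, List.getElem?_map]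
    have hlen := congrArg List.length h
    simp only [List.length_map, List.length_append] at hlen
    rcases Nat.lt_or_ge p u.length with hpu | hpu
    · rw [List.getElem?_append_left (by simpa using hpu), List.getElem?_map,
        List.getElem?_eq_getElem hpu] at hget
      simp only [inputAt] at hy ⊢
      rw [List.getElem?_eq_getElem hpu]
      cases hw : w[p]? with
      | none => simp [hw] at hget
      | some b =>
        rw [hw] at hy hget
        simp only [Option.map_some, Option.some.injEq] at hget
        cases hy with
        | letter hb => exact ⟨by rw [hget] at hb; cases hb; rfl, .inl (by omega)⟩
    · obtain rfl : p = u.length := by omega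
      have hz : (u.map some ++ r)[u.length]? = r.head? := by
        rw [List.getElem?_append_right (by simp), List.head?_eq_getElem?]; simp
      rw [hz] at hget
      simp only [inputAt] at hy
      rw [inputAt_length_succ]
      cases hw : w[u.length]? with
      | none =>
        rw [hw] at hy
        cases hy
        exact ⟨rfl, .inr (by rw [List.getElem?_eq_none_iff] at hw; omega)⟩
      | some b =>
        rw [hw] at hy hget
        cases hy with
        | letter hb =>
          rw [Option.map_some] at hget
          have := hr (f b) (by simp [← hget])
          rw [this] at hb; cases hb

theorem SymbolRel.inputAt {α β : Type*} {f : β → Option α} {w : List β} {u : List α}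
    (h : w.map f = u.map some) (p : ℕ) : SymbolRel f (inputAt w p) (inputAt u p) := by
  cases p with
  | zero => exact .leftEnd
  | succ p =>
    have hget : w[p]?.map f = u[p]?.map some := by rw [← List.getElem?_map, h, List.getElem?_map]
    simp only [AuxPDA.inputAt]
    cases hw : w[p]? <;> cases hu : u[p]? <;> simp only [hw, hu, Option.map_some, Option.map_none,
      Option.some.injEq, reduceCtorEq] at hget
    · exact .rightEnd
    · exact .letter hget

variable [Finite ι] {M : ∀ i, AuxPDA (α i)} {f : ∀ i, β → Option (α i)}

open Classical in
/-- A configuration of `M i` as a configuration of the union. -/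
noncomputable def unionConfig (f : ∀ i, β → Option (α i)) (i : ι) (c : (M i).Config) : (union M f).Config :=
  ⟨some ⟨i, c.state⟩, c.inputHead, fun p => Function.update (fun i => (M i).blank) i (c.workTape p),
    c.workHead, c.stack.map (Sigma.mk i)⟩

theorem union_perform_start (w : List β) (i : ι) :
    (union M f).perform w (union M f).initial
      ⟨some ⟨i, (M i).start⟩, .stay, fun i => (M i).blank, .stay, .keep⟩ =
    unionConfig f i (M i).initial := by
  simp [perform, initial, unionConfig, HeadMove.apply, StackOp.apply]

open Classical in
theorem union_perform (w : List β) {i : ι} (u : List (α i)) (c : (M i).Config)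
    (a : AuxPDAAction (M i).Q (M i).W (M i).Γ)
    (h : min (a.inputMove.apply c.inputHead) (w.length + 1) =
      min (a.inputMove.apply c.inputHead) (u.length + 1)) :
    (union M f).perform w (unionConfig f i c)
      ⟨some ⟨i, a.state⟩, a.inputMove,
        Function.update ((unionConfig f i c).workTape c.workHead) i a.write, a.workMove,
        mapStackOp (Sigma.mk i) a.stackOp⟩ = unionConfig f i ((M i).perform u c a) := by
  simp only [perform, unionConfig, mapStackOp_apply, h]
  congr 1
  funext p
  by_cases hp : p = c.workHead
  · subst hp; simp
  · simp [Function.update_of_ne hp]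

/-- Even on inputs that cannot be fully translated, every path comes from a path of some `M i` on
the longest translatable prefix, so the resource bounds carry over. -/
theorem union_reaches {u : ∀ i, List (α i)} {w : List β} {r : ∀ i, List (Option (α i))}
    (h : ∀ i, w.map (f i) = (u i).map some ++ r i) (hr : ∀ i, ∀ o ∈ (r i).head?, o = none)
    {k : ℕ} {c : (union M f).Config} (hk : (union M f).Reaches w k c) :
    (k = 0 ∧ c = (union M f).initial) ∨
      ∃ i k' c', k = k' + 1 ∧ c = unionConfig f i c' ∧ (M i).Reaches (u i) k' c' := by
  induction hk with
  | initial => exact .inl ⟨rfl, rfl⟩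
  | step _ hs ih =>
    obtain ⟨a, ha, rfl⟩ := hs
    rcases ih with ⟨rfl, rfl⟩ | ⟨i, k', c', rfl, rfl, hc'⟩
    · obtain ⟨i, rfl⟩ := ha
      exact .inr ⟨i, 0, _, rfl, union_perform_start w i, .initial⟩
    · obtain ⟨y, g, a, ha, hy, hg, rfl⟩ := ha
      have hle := hc'.inputHead_le
      obtain ⟨rfl, hp⟩ := hy.eq_inputAt (h i) (hr i) hle
      have hlen := congrArg List.length (h i)
      simp only [List.length_map, List.length_append] at hlen
      rw [← map_sigmaMk_head?_eq hg] at ha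
      refine .inr ⟨i, k' + 1, (M i).perform (u i) c' a, rfl, union_perform w (u i) c' a ?_,
        hc'.step ⟨a, ?_, rfl⟩⟩
      · rcases hp with hp | hp
        · have : a.inputMove.apply c'.inputHead ≤ c'.inputHead + 1 := by
            cases a.inputMove <;> simp [HeadMove.apply]; omega
          rw [min_eq_left (by omega), min_eq_left (by omega)]
        · rw [hp]
      · simpa [unionConfig] using ha

theorem union_step {i : ι} {w : List β} {u : List (α i)} (h : w.map (f i) = u.map some)
    {c c' : (M i).Config} (hs : (M i).Step u c c') :
    (union M f).Step w (unionConfig f i c) (unionConfig f i c') := by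
  obtain ⟨a, ha, rfl⟩ := hs
  have hlen : w.length = u.length := by simpa using congrArg List.length h
  refine ⟨_, ⟨_, _, a, ?_, .inputAt h _, List.head?_map, rfl⟩,
    (union_perform w u c a (by rw [hlen])).symm⟩
  simpa [unionConfig] using ha

end union

end AuxPDA

open AuxPDA in
/-- A finite union of recognized languages, read through partial maps of alphabets, is
recognized. -/
theorem RecognizedByOneWayAuxPDA.iUnion {ι : Type} [Finite ι] {α : ι → Type*} {β : Type*}
    {L : ∀ i, Language (α i)} (hL : ∀ i, RecognizedByOneWayAuxPDA (L i))
    (f : ∀ i, β → Option (α i)) :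
    RecognizedByOneWayAuxPDA ({w | ∃ i, ∃ u ∈ L i, w.map (f i) = u.map some} : Language β) := by
  have := Fintype.ofFinite ι
  choose M hM hC hp hacc using hL
  choose C hC using hC
  choose p hp using hp
  have hred : ∀ (w : List β) {k : ℕ} {c : (AuxPDA.union M f).Config},
      (AuxPDA.union M f).Reaches w k c → (k = 0 ∧ c = (AuxPDA.union M f).initial) ∨
      ∃ i k' c' u r, k = k' + 1 ∧ c = unionConfig f i c' ∧ (M i).Reaches u k' c' ∧
        w.map (f i) = u.map some ++ r := by
    intro w k c h
    choose u r h₁ h₂ using fun i => exists_maximal_prefix (f i) w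
    rcases union_reaches h₁ h₂ h with h | ⟨i, k', c', hk, hc, hr⟩
    · exact .inl h
    · exact .inr ⟨i, k', c', u i, r i, hk, hc, hr, h₁ i⟩
  have hlen : ∀ {i} {w : List β} {u : List (α i)} {r}, w.map (f i) = u.map some ++ r →
      w.length = u.length + r.length := fun h => by simpa using congrArg List.length h
  refine ⟨AuxPDA.union M f, ?_, ⟨∑ i, C i + 1, fun w k c h => ?_⟩,
    ⟨∑ i, p i + 1, fun w k c h => ?_⟩, ?_⟩
  · rintro (_ | ⟨i, q⟩) y x g a ha
    · obtain ⟨i, rfl⟩ := ha; simp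
    · obtain ⟨y', g', a', ha', -, -, rfl⟩ := ha
      exact hM i _ _ _ _ a' ha'
  · rcases hred w h with ⟨rfl, rfl⟩ | ⟨i, k', c', u, r, rfl, rfl, hr, hu⟩
    · simp [initial]
    · have h₁ := hC i _ _ _ hr
      have h₂ : Nat.log 2 u.length ≤ Nat.log 2 w.length := Nat.log_mono_right (by have := hlen hu; omega)
      have h₃ : C i ≤ ∑ i, C i + 1 :=
        (Finset.single_le_sum (fun _ _ => Nat.zero_le _) (Finset.mem_univ i)).trans (Nat.le_succ _)
      exact h₁.trans_le (Nat.mul_le_mul h₃ (Nat.succ_le_succ h₂))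
  · rcases hred w h with ⟨rfl, rfl⟩ | ⟨i, k', c', u, r, rfl, rfl, hr, hu⟩
    · exact Nat.zero_le _
    · have h₁ := (hp i _ _ _ hr).trans
        ((p i).eval_nat_mono (show u.length ≤ w.length by have := hlen hu; omega))
      have h₂ : (p i).eval w.length ≤ ∑ i, (p i).eval w.length :=
        Finset.single_le_sum (f := fun i => (p i).eval w.length)
          (fun _ _ => Nat.zero_le _) (Finset.mem_univ i)
      simp only [Polynomial.eval_add, Polynomial.eval_finsetSum, Polynomial.eval_one]
      omega
  · ext w
    constructor
    · rintro ⟨k, c, h, hend, hq⟩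
      rcases hred w h with ⟨rfl, rfl⟩ | ⟨i, k', c', u, r, rfl, rfl, hr, hu⟩
      · obtain ⟨_, _, _, h⟩ := hq; cases h
      · have h₁ := hr.inputHead_le
        have h₂ := hlen hu
        have h₃ : c'.inputHead = w.length + 1 := hend
        obtain rfl : r = [] := List.eq_nil_of_length_eq_zero (by omega)
        rw [List.append_nil] at hu
        refine ⟨i, u, ?_, hu⟩
        rw [← hacc i]
        obtain ⟨j, q, hq, he⟩ := hq
        cases he
        exact ⟨k', c', hr, by simp at h₂; omega, hq⟩
    · rintro ⟨i, u, hu, hw⟩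
      rw [← hacc i, mem_accepts_iff] at hu
      obtain ⟨c, hc, hend, hq⟩ := hu
      have h₂ : w.length = u.length := by simpa using congrArg List.length hw
      rw [mem_accepts_iff]
      refine ⟨unionConfig f i c, .head ⟨_, ⟨i, rfl⟩, (union_perform_start w i).symm⟩
        (hc.lift _ fun _ _ => union_step hw), ?_, i, _, hq, rfl⟩
      simp [unionConfig, hend, h₂]

/-! ### The word problem of a free product -/

open Monoid in
/-- A nonempty word in the factors of a free product that represents `1` has a nonempty subword in
one of the factors that represents `1` there. -/
theorem Monoid.CoprodI.exists_subword_prod_eq_one {ι : Type*} {M : ι → Type*} [∀ i, Monoid (M i)]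
    (l : List (Σ i, M i)) (hl : l ≠ [])
    (hprod : (l.map fun x => (CoprodI.of x.2 : CoprodI M)).prod = 1) :
    ∃ u i, ∃ x : List (M i), ∃ v, l = u ++ x.map (Sigma.mk i) ++ v ∧ x ≠ [] ∧ x.prod = 1 := by
  classical
  by_contra! hgood
  -- Multiply the syllables out from the right. The reduced word obtained starts with the product of
  -- some prefix of `l` in one factor; a further letter of that factor is merged into it, and by
  -- assumption the product is never 1. So nothing cancels, and a nonempty `l` gives a nonempty
  -- reduced word.
  have key : ∀ l : List (Σ i, M i),
      (∀ u i (x : List (M i)) v, l = u ++ x.map (Sigma.mk i) ++ v → x ≠ [] → x.prod ≠ 1) →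
      ∃ W : CoprodI.Word M, W.prod = (l.map fun x => (CoprodI.of x.2 : CoprodI M)).prod ∧
        (l = [] ∧ W = CoprodI.Word.empty ∨ ∃ i, ∃ x : List (M i), ∃ v, x ≠ [] ∧
          l = x.map (Sigma.mk i) ++ v ∧ W.toList.head? = some ⟨i, x.prod⟩) := by
    intro l
    induction l with
    | nil => exact fun _ => ⟨.empty, by simp, .inl ⟨rfl, rfl⟩⟩
    | cons a l ih =>
      obtain ⟨i, g⟩ := a
      intro h
      obtain ⟨W, hW, hW'⟩ := ih fun u j x v hl => h (⟨i, g⟩ :: u) j x v (by simp [hl])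
      have hg : g ≠ 1 := by simpa using h [] i [g] l (by simp) (by simp)
      by_cases hi : W.fstIdx = some i
      · rcases hW' with ⟨-, rfl⟩ | ⟨j, x, v, hx, rfl, hhead⟩
        · simp [CoprodI.Word.fstIdx] at hi
        · obtain rfl : j = i := by simpa [CoprodI.Word.fstIdx, hhead] using hi
          obtain ⟨t, ht⟩ : ∃ t, W.toList = ⟨j, x.prod⟩ :: t := List.head?_eq_some_iff.1 hhead
          have hgx : g * x.prod ≠ 1 := by
            simpa using h [] j (g :: x) v (by simp) (by simp)
          refine ⟨⟨⟨j, g * x.prod⟩ :: t, ?_, ?_⟩, ?_, .inr ⟨j, g :: x, v, by simp, by simp, by simp⟩⟩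
          · intro y hy
            rcases List.mem_cons.1 hy with rfl | hy
            · exact hgx
            · exact W.ne_one y (by simp [ht, hy])
          · have := W.chain_ne
            rw [ht] at this
            rw [List.isChain_cons] at this ⊢
            exact this
          · rw [List.map_cons, List.prod_cons, ← hW]
            simp [CoprodI.Word.prod, ht, mul_assoc]
      · exact ⟨CoprodI.Word.cons g W hi hg, by simp [hW], .inr ⟨i, [g], l, by simp, by simp,
          by simp [CoprodI.Word.cons]⟩⟩
  obtain ⟨W, hW, hW'⟩ := key l hgood
  rw [hprod, ← CoprodI.Word.prod_empty] at hW
  obtain rfl : W = .empty := (CoprodI.Word.equiv (M := M)).symm.injective hW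
  rcases hW' with ⟨h, -⟩ | ⟨i, x, v, -, -, h⟩
  · exact hl h
  · simp [CoprodI.Word.empty] at h

section

variable {G H : Type*} [Group G] [Group H]

open Monoid in
/-- The word problem of a free product, for letters of which each comes from one of the factors, is
the insertion closure of the union of the word problems of the factors. -/
theorem wordProblem_coprod_iff {β : Type*} (val : β → Coprod G H) {S : Set G} {T : Set H}
    (fG : β → Option S) (fH : β → Option T)
    (hG : ∀ b s, fG b = some s → Coprod.inl (s : G) = val b)
    (hH : ∀ b t, fH b = some t → Coprod.inr (t : H) = val b)
    (hcover : ∀ b, fG b = none → fH b ≠ none) {L : Language β}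
    (hL : ∀ w, w ∈ L ↔ (∃ u ∈ wordProblem S, w.map fG = u.map some) ∨
      ∃ u ∈ wordProblem T, w.map fH = u.map some) (w : List β) :
    (w.map val).prod = 1 ↔ InsertionClosure L w := by
  have hmapG : ∀ (x : List β) (u : List S), x.map fG = u.map some →
      (x.map val).prod = Coprod.inl (u.map fun a : S => (a : G)).prod := by
    intro x
    induction x with
    | nil => intro u hu; simp [List.map_eq_nil_iff.1 hu.symm]
    | cons b x ih =>
      intro u hu
      cases u with
      | nil => simp at hu
      | cons s u =>
        simp only [List.map_cons, List.cons.injEq] at hu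
        simp [ih u hu.2, hG b s hu.1]
  have hmapH : ∀ (x : List β) (u : List T), x.map fH = u.map some →
      (x.map val).prod = Coprod.inr (u.map fun a : T => (a : H)).prod := by
    intro x
    induction x with
    | nil => intro u hu; simp [List.map_eq_nil_iff.1 hu.symm]
    | cons b x ih =>
      intro u hu
      cases u with
      | nil => simp at hu
      | cons s u =>
        simp only [List.map_cons, List.cons.injEq] at hu
        simp [ih u hu.2, hH b s hu.1]
  constructor
  -- The constant family `G × H` embeds both factors into one type, as an indexed coproduct needs a
  -- family in a single universe. A letter with a preimage on both sides is assigned to `G`.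
  · let τ : β → Σ _ : Bool, G × H := fun b => match fG b with
      | some s => ⟨true, (s, 1)⟩
      | none => match fH b with
        | some t => ⟨false, (1, t)⟩
        | none => ⟨true, 1⟩
    -- That `Φ` is a homomorphism suffices: words of value 1 are only transported forward.
    let Φ : Coprod G H →* CoprodI (fun _ : Bool => G × H) := Coprod.lift
      ((CoprodI.of (i := true)).comp (MonoidHom.inl G H))
      ((CoprodI.of (i := false)).comp (MonoidHom.inr G H))
    have hτ : ∀ b, CoprodI.of (M := fun _ : Bool => G × H) (i := (τ b).1) (τ b).2 = Φ (val b) := by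
      intro b
      cases hs : fG b with
      | some s => simp only [τ, hs, ← hG b s hs]; simp [Φ]
      | none =>
        cases ht : fH b with
        | some t => simp only [τ, hs, ht, ← hH b t ht]; simp [Φ]
        | none => exact absurd ht (hcover b hs)
    have hxG : ∀ (x : List β) (y : List (G × H)), x.map τ = y.map (Sigma.mk true) →
        ∃ u : List S, x.map fG = u.map some ∧ y = u.map fun s : S => ((s : G), (1 : H)) := by
      intro x
      induction x with
      | nil => intro y hy; exact ⟨[], rfl, List.map_eq_nil_iff.1 hy.symm⟩
      | cons b x ih =>
        intro y hy
        cases y with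
        | nil => simp at hy
        | cons g y =>
          simp only [List.map_cons, List.cons.injEq] at hy
          obtain ⟨u, hu, rfl⟩ := ih y hy.2
          have hb := hy.1
          cases hs : fG b with
          | some s =>
            simp only [τ, hs, Sigma.mk.injEq, heq_eq_eq, true_and] at hb
            exact ⟨s :: u, by simp [hs, hu], by simp [hb]⟩
          | none =>
            cases ht : fH b with
            | some t => simp [τ, hs, ht] at hb
            | none => exact absurd ht (hcover b hs)
    have hxH : ∀ (x : List β) (y : List (G × H)), x.map τ = y.map (Sigma.mk false) →
        ∃ u : List T, x.map fH = u.map some ∧ y = u.map fun s : T => ((1 : G), (s : H)) := by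
      intro x
      induction x with
      | nil => intro y hy; exact ⟨[], rfl, List.map_eq_nil_iff.1 hy.symm⟩
      | cons b x ih =>
        intro y hy
        cases y with
        | nil => simp at hy
        | cons g y =>
          simp only [List.map_cons, List.cons.injEq] at hy
          obtain ⟨u, hu, rfl⟩ := ih y hy.2
          have hb := hy.1
          cases hs : fG b with
          | some s => simp [τ, hs] at hb
          | none =>
            cases ht : fH b with
            | some t =>
              simp only [τ, hs, ht, Sigma.mk.injEq, heq_eq_eq, true_and] at hb
              exact ⟨t :: u, by simp [ht, hu], by simp [hb]⟩
            | none => exact absurd ht (hcover b hs)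
    induction hn : w.length using Nat.strong_induction_on generalizing w with
    | _ n ih =>
      intro hw
      rcases eq_or_ne w [] with rfl | hne
      · exact .nil
      obtain ⟨l₁, i, y, l₂, hl, hy, hyp⟩ := CoprodI.exists_subword_prod_eq_one (w.map τ)
        (by simpa using hne) (by
          rw [List.map_map, ← map_one Φ, ← hw, map_list_prod, List.map_map]
          exact congrArg List.prod (List.map_congr_left fun b _ => hτ b))
      obtain ⟨w', v, rfl, hw', rfl⟩ := List.map_eq_append_iff.1 hl
      obtain ⟨u, x, rfl, rfl, hx⟩ := List.map_eq_append_iff.1 hw'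
      have hxL : x ∈ L := by
        rw [hL]
        cases i with
        | true =>
          obtain ⟨s, hs, rfl⟩ := hxG x y hx
          refine .inl ⟨s, ?_, hs⟩
          have := congrArg (MonoidHom.fst G H) hyp
          rw [map_list_prod, List.map_map] at this
          exact this
        | false =>
          obtain ⟨s, hs, rfl⟩ := hxH x y hx
          refine .inr ⟨s, ?_, hs⟩
          have := congrArg (MonoidHom.snd G H) hyp
          rw [map_list_prod, List.map_map] at this
          exact this
      have hx1 : (x.map val).prod = 1 := by
        rcases (hL x).1 hxL with ⟨s, hs, h⟩ | ⟨s, hs, h⟩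
        · rw [hmapG x s h, show _ = (1 : G) from hs, map_one]
        · rw [hmapH x s h, show _ = (1 : H) from hs, map_one]
      refine .insert (ih (u ++ v).length ?_ (u ++ v) rfl ?_) hxL
      · have : x ≠ [] := by rintro rfl; exact hy (List.map_eq_nil_iff.1 hx.symm)
        have := List.length_pos_of_ne_nil this
        simp at hn ⊢; omega
      · simpa [hx1] using hw
  · intro h
    induction h with
    | nil => simp
    | @insert u v x _ hx ih =>
      have hx1 : (x.map val).prod = 1 := by
        rcases (hL x).1 hx with ⟨s, hs, h⟩ | ⟨s, hs, h⟩
        · rw [hmapG x s h, show _ = (1 : G) from hs, map_one]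
        · rw [hmapH x s h, show _ = (1 : H) from hs, map_one]
      simpa [hx1] using ih

end

/-! ### Counters in signed binary notation -/

namespace SignedDigit

/-- The carry produced when the digit `c` is added to the digit `d`. -/
def carryOut (d c : SignType) : SignType := if d = c then d else 0

/-- The digit that remains when the digit `c` is added to the digit `d`. -/
def digit (d c : SignType) : SignType := if d = 0 then c else if c = 0 then d else 0

/-- `1` for a nonzero digit and `0` for a zero one. -/
def weight (d : SignType) : ℕ := if d = 0 then 0 else 1

theorem digit_add_carryOut (d c : SignType) : (digit d c : ℤ) + 2 * carryOut d c = d + c := by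
  revert d c; decide

/-- The potential inequality: a nonzero carry out arises only from two equal nonzero digits, and it
leaves the digit 0. -/
theorem weight_le (d c : SignType) :
    2 * weight (carryOut d c) + weight (digit d c) ≤ weight d + weight c := by
  revert d c; decide

theorem digit_zero_left (c : SignType) : digit 0 c = c := by simp [digit]

theorem carryOut_zero_left (c : SignType) : carryOut 0 c = 0 := by
  unfold carryOut; split <;> rfl

/-- The carry into position `i` when `c` is added to the number with the digits `d`. -/
def carry (d : ℕ → SignType) (c : SignType) : ℕ → SignType
  | 0 => c
  | i + 1 => carryOut (d i) (carry d c i)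

/-- The digits of the sum of `c` and the number with the digits `d`. -/
def add (d : ℕ → SignType) (c : SignType) (i : ℕ) : SignType := digit (d i) (carry d c i)

/-- Whether the first `i` digits are zero. -/
def allZero (d : ℕ → SignType) : ℕ → Bool
  | 0 => true
  | i + 1 => allZero d i && decide (d i = 0)

theorem allZero_iff (d : ℕ → SignType) (m : ℕ) : allZero d m = true ↔ ∀ i < m, d i = 0 := by
  induction m with
  | zero => simp [allZero]
  | succ m ih =>
    rw [allZero, Bool.and_eq_true, ih, Nat.forall_lt_succ_right, decide_eq_true_iff]

/-- The value of the first `m` digits. -/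
def value (d : ℕ → SignType) (m : ℕ) : ℤ := ∑ i ∈ Finset.range m, (d i : ℤ) * 2 ^ i

theorem value_add (d : ℕ → SignType) (c : SignType) (m : ℕ) :
    value (add d c) m + carry d c m * 2 ^ m = value d m + c := by
  induction m with
  | zero => simp [value, carry]
  | succ m ih =>
    have h := digit_add_carryOut (d m) (carry d c m)
    simp only [value, Finset.sum_range_succ, carry, add] at ih ⊢
    rw [pow_succ]
    linear_combination ih + 2 ^ m * h

theorem value_succ (d : ℕ → SignType) (m : ℕ) : value d (m + 1) = value d m + d m * 2 ^ m :=
  Finset.sum_range_succ _ _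

/-- Zero has a unique representation, although other numbers do not: by parity the lowest digit
vanishes, and one divides by 2. -/
theorem value_eq_zero_iff (d : ℕ → SignType) (m : ℕ) : value d m = 0 ↔ ∀ i < m, d i = 0 := by
  refine ⟨fun h => ?_, fun h => Finset.sum_eq_zero fun i hi => by
    rw [h i (Finset.mem_range.1 hi)]; simp⟩
  induction m generalizing d with
  | zero => simp
  | succ m ih =>
    have hv : value d (m + 1) = 2 * value (fun i => d (i + 1)) m + d 0 := by
      simp only [value, Finset.sum_range_succ', Finset.mul_sum, pow_succ, pow_zero, mul_one]
      congr 1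
      exact Finset.sum_congr rfl fun i _ => by ring
    rw [hv] at h
    have h0 : d 0 = 0 := by
      generalize d 0 = s at h
      cases s
      · rfl
      · change _ + (-1 : ℤ) = 0 at h; omega
      · change _ + (1 : ℤ) = 0 at h; omega
    rw [h0] at h
    have h1 := ih (fun i => d (i + 1)) (by simpa using h)
    intro i hi
    cases i with
    | zero => exact h0
    | succ i => exact h1 i (by omega)

/-- The numbers `A i` bound how often a carry has entered position `i`. -/
def Amortized (d : ℕ → SignType) (A : ℕ → ℕ) : Prop :=
  ∀ i, 2 * A (i + 1) + weight (d i) ≤ A i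

theorem Amortized.add {d : ℕ → SignType} {A : ℕ → ℕ} (h : Amortized d A) (c : SignType) :
    Amortized (add d c) fun i => A i + weight (carry d c i) := fun i => by
  have h₁ := h i
  have h₂ := weight_le (d i) (carry d c i)
  simp only [SignedDigit.add, carry]
  omega

theorem Amortized.pow_mul_le {d : ℕ → SignType} {A : ℕ → ℕ} (h : Amortized d A) (i : ℕ) :
    2 ^ i * A i ≤ A 0 := by
  induction i with
  | zero => simp
  | succ i ih =>
    have h₁ := h i
    calc 2 ^ (i + 1) * A (i + 1) = 2 ^ i * (2 * A (i + 1)) := by ring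
      _ ≤ 2 ^ i * A i := Nat.mul_le_mul_left _ (by omega)
      _ ≤ A 0 := ih

/-- After the addition position `m` has received at least one nonzero carry, which position 0 has
paid for `2 ^ m` times. -/
theorem Amortized.le_log {d : ℕ → SignType} {A : ℕ → ℕ} (h : Amortized d A) {c : SignType} {m n : ℕ}
    (hm : carry d c m ≠ 0) (hn : A 0 + weight c ≤ n) : m ≤ Nat.log 2 n := by
  have h₁ := (h.add c).pow_mul_le m
  have h₂ : 2 ^ m ≤ n := by
    have : weight (carry d c m) = 1 := by simp [weight, hm]
    simp only [carry] at h₁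
    have h₃ : 2 ^ m * 1 ≤ 2 ^ m * (A m + weight (carry d c m)) := Nat.mul_le_mul_left _ (by omega)
    omega
  exact Nat.le_log_of_pow_le (by norm_num) h₂

end SignedDigit

/-! ### The counting machine: transitions and addition routine -/

namespace AuxPDA

open SignedDigit

/-- States of the machine that runs an automaton with states `Q` and a counter. The first component
of `sim` tells whether the counter is zero. -/
inductive CountState (Q : Type)
  | init : CountState Q
  | sim : Bool → Q → CountState Q
  | walk : SignType → Q → CountState Q
  | rewind : SignType → Q → CountState Q
  | carry : SignType → Bool → Q → CountState Q
  | unwind : Bool → Q → CountState Q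

instance {Q : Type} [Finite Q] : Finite (CountState Q) :=
  Finite.of_injective
    (fun s : CountState Q => (match s with
      | .init => none
      | .sim z q => some (q, .inl (z, true))
      | .walk c q => some (q, .inr (.inl (c, true)))
      | .rewind c q => some (q, .inr (.inl (c, false)))
      | .carry c z q => some (q, .inr (.inr (c, z)))
      | .unwind z q => some (q, .inl (z, false)) :
      Option (Q × ((Bool × Bool) ⊕ (SignType × Bool) ⊕ (SignType × Bool)))))
    (by rintro (_ | _ | _ | _ | _ | _) (_ | _ | _ | _ | _ | _) h <;> simp_all)

variable {α β : Type*}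

/-- Transitions of the counting machine. A letter `b` with `f b = inr c` changes the counter by `c`;
the letters of the form `inl a` are processed by `K`. -/
def countTrans (K : AuxPDA α) (f : β → α ⊕ SignType) : CountState K.Q → InputSymbol β →
    Bool × Option (K.W × SignType) → Option (Option K.Γ) →
    Set (AuxPDAAction (CountState K.Q) (Bool × Option (K.W × SignType)) (Option K.Γ))
  | .init, _, _, _ => {⟨.sim true K.start, .stay, (true, none), .stay, .keep⟩}
  | .sim z q, y, x, g => {a |
      (∃ y' g', ∃ a' ∈ K.trans q y' (x.2.getD (K.blank, 0)).1 g',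
        SymbolRel (fun b => (f b).getLeft?) y y' ∧ g = g'.map some ∧
        a = ⟨.sim z a'.state, a'.inputMove, (x.1, some (a'.write, (x.2.getD (K.blank, 0)).2)),
          a'.workMove, mapStackOp some a'.stackOp⟩) ∨
      ∃ b c, y = .letter b ∧ f b = .inr c ∧ a = ⟨.walk c q, .right, x, .stay, .keep⟩}
  | .walk c q, _, (b, some x), _ => {⟨.walk c q, .stay, (b, some x), .right, .push none⟩}
  | .walk c q, _, (b, none), _ => {⟨.rewind c q, .stay, (b, none), .stay, .keep⟩}
  | .rewind c q, _, (b, x), _ =>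
    {⟨if b then .carry c true q else .rewind c q, .stay, (b, x), if b then .stay else .left, .keep⟩}
  | .carry c z q, _, (b, some x), _ =>
    {⟨.carry (carryOut x.2 c) (z && decide (digit x.2 c = 0)) q, .stay,
      (b, some (x.1, digit x.2 c)), .right, .keep⟩}
  | .carry c z q, _, (b, none), _ =>
    {⟨.unwind (z && decide (c = 0)) q, .stay, (b, if c = 0 then none else some (K.blank, c)), .stay,
      .keep⟩}
  | .unwind z q, _, x, some none => {⟨.unwind z q, .stay, x, .left, .pop⟩}
  | .unwind z q, _, x, _ => {⟨.sim z q, .stay, x, .stay, .keep⟩}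

/-- The machine that runs `K` and keeps a counter, written in binary with the digits `-1, 0, 1`, on
a second track of the work tape. -/
abbrev count (K : AuxPDA α) (f : β → α ⊕ SignType) : AuxPDA β where
  Q := CountState K.Q
  W := Bool × Option (K.W × SignType)
  Γ := Option K.Γ
  finite_Q := by have := K.finite_Q; infer_instance
  finite_W := by have := K.finite_W; infer_instance
  finite_Γ := by have := K.finite_Γ; infer_instance
  start := .init
  accepting := {q | ∃ q' ∈ K.accepting, q = .sim true q'}
  blank := (false, none)
  trans := countTrans K f

theorem count_oneWay {K : AuxPDA α} (hK : K.OneWay) (f : β → α ⊕ SignType) :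
    (count K f).OneWay := by
  rintro q x y t a ha
  change a ∈ countTrans K f q x y t at ha
  unfold countTrans at ha
  split at ha
  case h_2 =>
    rcases ha with ⟨y', g', a', ha', -, -, rfl⟩ | ⟨b, c, -, -, rfl⟩
    · exact hK _ _ _ _ a' ha'
    · simp
  all_goals
    rw [Set.mem_singleton_iff.1 ha]
    simp

theorem markedTape_congr {V : Type*} {m : ℕ} {t t' : ℕ → V} (h : ∀ i < m, t i = t' i) :
    markedTape m t = markedTape m t' := by
  funext i
  by_cases hi : i < m <;> simp [markedTape, hi]
  exact h i hi

section loops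

variable {K : AuxPDA α} {f : β → α ⊕ SignType} {w : List β} {B h : ℕ} {t : ℕ → K.W × SignType}

theorem count_walk (hh : h ≤ w.length + 1) (c : SignType) (q : K.Q) {m : ℕ} (hm : m < B) (d p : ℕ)
    (s : List (Option K.Γ)) (hd : p + d = m) :
    Run (count K f) w B (d + 1) ⟨.walk c q, h, markedTape m t, p, s⟩
      ⟨.rewind c q, h, markedTape m t, m, List.replicate d none ++ s⟩ := by
  induction d generalizing p s with
  | zero =>
    obtain rfl : p = m := hd
    have e := markedTape_of_le t (le_refl p)
    exact .of_stay (M := count K f) (.rewind c q) (decide (p = 0), none) .stay .keep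
      (markedTape p t) p s (congrArg (countTrans K f (.walk c q) _ · _) e)
      (e ▸ Function.update_eq_self _ _) rfl rfl hh hm (by rintro ⟨_, _, ⟨⟩⟩) (.refl _)
  | succ d ih =>
    have e := markedTape_of_lt t (show p < m by omega)
    refine .of_stay (M := count K f) (.walk c q) (decide (p = 0), some (t p)) .right
      (.push none) (markedTape m t) (p + 1) (none :: s)
      (congrArg (countTrans K f (.walk c q) _ · _) e)
      (e ▸ Function.update_eq_self _ _) rfl rfl hh (by omega) (by rintro ⟨_, _, ⟨⟩⟩) ?_
    rw [List.replicate_succ', List.append_assoc]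
    exact ih (p + 1) (none :: s) (by omega)

theorem count_rewind (hh : h ≤ w.length + 1) (c : SignType) (q : K.Q) (m i : ℕ) (hi : i < B)
    (s : List (Option K.Γ)) :
    Run (count K f) w B (i + 1) ⟨.rewind c q, h, markedTape m t, i, s⟩
      ⟨.carry c true q, h, markedTape m t, 0, s⟩ := by
  induction i with
  | zero =>
    exact .of_stay (M := count K f) (.carry c true q) (markedTape m t 0) .stay .keep
      (markedTape m t) 0 s rfl (Function.update_eq_self _ _) rfl rfl hh hi
      (by rintro ⟨_, _, ⟨⟩⟩) (.refl _)
  | succ i ih =>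
    exact .of_stay (M := count K f) (.rewind c q) (markedTape m t (i + 1)) .left .keep
      (markedTape m t) i s rfl (Function.update_eq_self _ _) rfl rfl hh hi
      (by rintro ⟨_, _, ⟨⟩⟩) (ih (by omega))

/-- The tape during the addition of `c` to the counter: the first `i` digits have been updated. -/
def addTape {W : Type} (t : ℕ → W × SignType) (c : SignType) (i j : ℕ) : W × SignType :=
  if j < i then ((t j).1, add (fun k => (t k).2) c j) else t j

theorem count_carry (hh : h ≤ w.length + 1) (c : SignType) (q : K.Q) {m : ℕ} (hm : m < B)
    (s : List (Option K.Γ)) (d i : ℕ) (hd : i + d = m) :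
    Run (count K f) w B d
      ⟨.carry (carry (fun k => (t k).2) c i)
        (allZero (add (fun k => (t k).2) c) i) q, h, markedTape m (addTape t c i), i, s⟩
      ⟨.carry (carry (fun k => (t k).2) c m)
        (allZero (add (fun k => (t k).2) c) m) q, h, markedTape m (addTape t c m), m,
        s⟩ := by
  induction d generalizing i with
  | zero => obtain rfl : i = m := hd; exact .refl _
  | succ d ih =>
    have hi : i < m := by omega
    have e := markedTape_of_lt (addTape t c i) hi
    have e' : addTape t c i i = t i := by simp [addTape]
    rw [e'] at e
    refine .of_stay (M := count K f)
      (.carry (carry (fun k => (t k).2) c (i + 1))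
        (allZero (add (fun k => (t k).2) c) (i + 1)) q)
      (decide (i = 0), some ((t i).1, add (fun k => (t k).2) c i)) .right .keep
      (markedTape m (addTape t c (i + 1))) (i + 1) s
      (congrArg (countTrans K f (.carry _ _ q) (inputAt w h) · s.head?) e) ?_ rfl rfl hh
      (by omega) (by rintro ⟨_, _, ⟨⟩⟩) (ih (i + 1) (by omega))
    · rw [update_markedTape_write _ _ hi.le, max_eq_left (by omega)]
      congr 1
      funext j
      rcases lt_trichotomy j i with hj | rfl | hj
      · simp [addTape, Function.update_of_ne hj.ne, hj, show j < i + 1 by omega]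
      · simp [addTape]
      · simp [addTape, Function.update_of_ne hj.ne', show ¬ j < i by omega,
          show ¬ j < i + 1 by omega]

/-- The first unvisited cell holds the digit 0, so an outgoing carry becomes the digit there and
propagates no further. With a zero carry the cell stays unvisited and the counter does not grow. -/
theorem count_carry_end (hh : h ≤ w.length + 1) (c : SignType) (q : K.Q) {m : ℕ} (hm : m < B)
    (ht : ∀ i, m ≤ i → t i = (K.blank, 0)) (s : List (Option K.Γ)) (z : Bool) :
    Run (count K f) w B 1
      ⟨.carry (carry (fun k => (t k).2) c m) z q, h, markedTape m (addTape t c m), m, s⟩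
      ⟨.unwind (z && decide (carry (fun k => (t k).2) c m = 0)) q, h,
        markedTape (if carry (fun k => (t k).2) c m = 0 then m else m + 1)
          (fun j => ((t j).1, add (fun k => (t k).2) c j)), m, s⟩ := by
  have e := markedTape_of_le (addTape t c m) (le_refl m)
  have ec : markedTape m (addTape t c m) =
      markedTape m (fun j => ((t j).1, add (fun k => (t k).2) c j)) :=
    markedTape_congr fun i hi => by simp [addTape, hi]
  refine .of_stay (M := count K f) (.unwind (z && decide (carry (fun k => (t k).2) c m = 0)) q)
    (decide (m = 0), if carry (fun k => (t k).2) c m = 0 then none else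
      some (K.blank, carry (fun k => (t k).2) c m)) .stay .keep _ m s
    (congrArg (countTrans K f (.carry _ z q) (inputAt w h) · s.head?) e) ?_ rfl rfl hh hm
    (by rintro ⟨_, _, ⟨⟩⟩) (.refl _)
  split
  · rw [← e, Function.update_eq_self, ec]
  · rw [ec, ← update_markedTape_extend]
    congr 2
    simp [add, ht m le_rfl, digit_zero_left]

theorem count_unwind (hh : h ≤ w.length + 1) (z : Bool) (q : K.Q) (d p : ℕ) (hB : p + d < B)
    (s : List K.Γ) (T : ℕ → Bool × Option (K.W × SignType)) :
    Run (count K f) w B (d + 1)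
      ⟨.unwind z q, h, T, p + d, List.replicate d none ++ s.map some⟩
      ⟨.sim z q, h, T, p, s.map some⟩ := by
  induction d with
  | zero =>
    refine .of_stay (M := count K f) (.sim z q) (T p) .stay .keep T p (s.map some) ?_
      (Function.update_eq_self _ _) rfl rfl hh hB (by rintro ⟨_, _, ⟨⟩⟩) (.refl _)
    cases s <;> rfl
  | succ d ih =>
    exact .of_stay (M := count K f) (.unwind z q) (T (p + (d + 1))) .left .pop T (p + d)
      (List.replicate d none ++ s.map some) rfl (Function.update_eq_self _ _) rfl rfl hh hB
      (by rintro ⟨_, _, ⟨⟩⟩) (ih (by omega))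

/-- The symbols `none` pushed on the way to cell `m` remember the head position of `K` above its own
stack. The carry pass ends at `m` again, so popping them brings the head back to `p`. -/
theorem count_add (hh : h ≤ w.length + 1) (c : SignType) (q : K.Q) {m p : ℕ} (hp : p ≤ m)
    (hm : m < B) (ht : ∀ i, m ≤ i → t i = (K.blank, 0)) (s : List K.Γ) :
    ∃ j ≤ 4 * B, Run (count K f) w B j
      ⟨.walk c q, h, markedTape m t, p, s.map some⟩
      ⟨.sim (allZero (add (fun k => (t k).2) c) m &&
          decide (carry (fun k => (t k).2) c m = 0)) q, h,
        markedTape (if carry (fun k => (t k).2) c m = 0 then m else m + 1)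
          (fun j => ((t j).1, add (fun k => (t k).2) c j)), p, s.map some⟩ := by
  have h₁ := count_walk (f := f) (t := t) hh c q hm (m - p) p (s.map some) (by omega)
  have h₂ := h₁.trans (count_rewind hh c q m m hm _)
  have h₃ := count_carry (f := f) (t := t) hh c q hm (List.replicate (m - p) none ++ s.map some)
    m 0 (by omega)
  have e₀ : addTape t c 0 = t := by funext j; simp [addTape]
  rw [e₀] at h₃
  have h₄ := h₃.trans (count_carry_end hh c q hm ht _ _)
  have h₅ := count_unwind (f := f) hh (allZero (add (fun k => (t k).2) c) m &&
    decide (carry (fun k => (t k).2) c m = 0)) q (m - p) p (B := B) (by omega) s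
    (markedTape (if carry (fun k => (t k).2) c m = 0 then m else m + 1)
          (fun j => ((t j).1, add (fun k => (t k).2) c j)))
  rw [Nat.add_sub_cancel' hp] at h₅
  exact ⟨_, by omega, h₂.trans (h₄.trans h₅)⟩

end loops

end AuxPDA

/-! ### The counting machine: invariant, soundness and resource bounds -/

namespace AuxPDA

open SignedDigit Relation

variable {α β : Type*}

/-- The letters of a word that are passed on to the automaton. -/
def lettersOf (f : β → α ⊕ SignType) (w : List β) : List α := w.filterMap fun b => (f b).getLeft?

/-- The sum of the changes of the counter that a word prescribes. -/
def total (f : β → α ⊕ SignType) (w : List β) : ℤ :=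
  ((w.filterMap fun b => (f b).getRight?).map fun s : SignType => (s : ℤ)).sum

theorem total_append (f : β → α ⊕ SignType) (u v : List β) :
    total f (u ++ v) = total f u + total f v := by simp [total]

theorem lettersOf_append (f : β → α ⊕ SignType) (u v : List β) :
    lettersOf f (u ++ v) = lettersOf f u ++ lettersOf f v := by simp [lettersOf]

/-- The position `h` on the input `w` corresponds to the position `p` on the input of the simulated
automaton, and `z` is what has been read so far. -/
def CountPos (f : β → α ⊕ SignType) (w z : List β) (h p : ℕ) : Prop :=
  (h = 0 ∧ p = 0 ∧ z = []) ∨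
    ∃ rest, w = z ++ rest ∧ h = z.length + 1 ∧ p = (lettersOf f z).length + 1

section CountPos

variable {f : β → α ⊕ SignType} {w z : List β} {h p : ℕ}

theorem CountPos.length_le (hp : CountPos f w z h p) : z.length ≤ w.length := by
  rcases hp with ⟨-, -, rfl⟩ | ⟨rest, rfl, -⟩ <;> simp

theorem CountPos.symbolRel (hp : CountPos f w z h p)
    (hw : ∀ b s, inputAt w h = .letter b → f b ≠ .inr s) :
    SymbolRel (fun b => (f b).getLeft?) (inputAt w h) (inputAt (lettersOf f w) p) := by
  rcases hp with ⟨rfl, rfl, rfl⟩ | ⟨rest, rfl, rfl, rfl⟩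
  · exact .leftEnd
  · cases rest with
    | nil =>
      rw [List.append_nil, inputAt_length_succ, inputAt_length_succ]
      exact .rightEnd
    | cons b rest =>
      rw [inputAt_append_cons] at hw ⊢
      cases hb : f b with
      | inr s => exact absurd hb (hw b s rfl)
      | inl a =>
        have e : lettersOf f (z ++ b :: rest) = lettersOf f z ++ a :: lettersOf f rest := by
          simp [lettersOf, hb]
        rw [e, inputAt_append_cons]
        exact .letter (by simp [hb])

theorem CountPos.next (hp : CountPos f w z h p) {y : InputSymbol α}
    (hy : SymbolRel (fun b => (f b).getLeft?) (inputAt w h) y) {mv : HeadMove} (hmv : mv ≠ .left) :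
    y = inputAt (lettersOf f w) p ∧ ∃ z', CountPos f w z' (min (mv.apply h) (w.length + 1))
      (min (mv.apply p) ((lettersOf f w).length + 1)) ∧ total f z' = total f z ∧
      z.length ≤ z'.length := by
  have hstay : CountPos f w z (min h (w.length + 1)) (min p ((lettersOf f w).length + 1)) := by
    rcases hp with ⟨rfl, rfl, rfl⟩ | ⟨rest, rfl, rfl, rfl⟩
    · exact .inl (by simp)
    · exact .inr ⟨rest, rfl, by simp, by simp [lettersOf_append]⟩
  rcases hp with ⟨rfl, rfl, rfl⟩ | ⟨rest, rfl, rfl, rfl⟩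
  · refine ⟨by cases hy; rfl, ?_⟩
    cases mv with
    | left => exact absurd rfl hmv
    | stay => exact ⟨[], hstay, rfl, le_rfl⟩
    | right => exact ⟨[], .inr ⟨w, rfl, by simp [HeadMove.apply], by simp [HeadMove.apply, lettersOf]⟩,
        rfl, le_rfl⟩
  · cases rest with
    | nil =>
      rw [List.append_nil] at *
      rw [inputAt_length_succ] at hy ⊢
      refine ⟨by cases hy; rfl, z, .inr ⟨[], by simp, ?_⟩, rfl, le_rfl⟩
      cases mv with
      | left => exact absurd rfl hmv
      | stay => simp [HeadMove.apply]
      | right => simp [HeadMove.apply]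
    | cons b rest =>
      rw [inputAt_append_cons] at hy
      cases hy with
      | @letter _ a hb =>
        have hb : f b = .inl a := Sum.getLeft?_eq_some_iff.1 hb
        have e : lettersOf f (z ++ b :: rest) = lettersOf f z ++ a :: lettersOf f rest := by
          simp [lettersOf, hb]
        refine ⟨by rw [e, inputAt_append_cons], ?_⟩
        cases mv with
        | left => exact absurd rfl hmv
        | stay => exact ⟨z, hstay, rfl, le_rfl⟩
        | right =>
          refine ⟨z ++ [b], .inr ⟨rest, by simp, by simp [HeadMove.apply], ?_⟩, ?_, by simp⟩
          · rw [e]; simp [HeadMove.apply, lettersOf, hb]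
          · simp [total_append]; simp [total, hb]

end CountPos

/-- The configuration of the counting machine that simulates the configuration `c` of `K`. -/
def countConfig {K : AuxPDA α} (f : β → α ⊕ SignType) (z : Bool) (h m : ℕ)
    (t : ℕ → K.W × SignType) (c : K.Config) : (count K f).Config :=
  ⟨.sim z c.state, h, markedTape m t, c.workHead, c.stack.map some⟩

/-- The invariant of the counting machine, after `z` has been read and `K` has made `j` steps. -/
structure CountInv {K : AuxPDA α} (f : β → α ⊕ SignType) (w : List β) (B : ℕ) (z : List β) (j : ℕ)
    (c : K.Config) (h m : ℕ) (t : ℕ → K.W × SignType) (A : ℕ → ℕ) (zero : Bool) : Prop where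
  pos : CountPos f w z h c.inputHead
  reaches : K.Reaches (lettersOf f w) j c
  tape : ∀ i, (t i).1 = c.workTape i
  blank : ∀ i, m ≤ i → t i = (K.blank, 0)
  head_le : c.workHead ≤ m
  lt : m < B
  zero_iff : zero = true ↔ total f z = 0
  value_eq : value (fun i => (t i).2) m = total f z
  amortized : Amortized (fun i => (t i).2) A
  le_length : A 0 ≤ z.length

section

variable {K : AuxPDA α} {f : β → α ⊕ SignType} {w z : List β} {B j h m : ℕ} {c : K.Config}
  {t : ℕ → K.W × SignType} {A : ℕ → ℕ} {zero : Bool}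

theorem CountInv.next (hI : CountInv f w B z j c h m t A zero) (hB : c.workHead + 1 < B)
    {a : AuxPDAAction K.Q K.W K.Γ} (ha : a ∈ K.trans c.state
      (inputAt (lettersOf f w) c.inputHead) (c.workTape c.workHead) c.stack.head?)
    {y : InputSymbol α} (hy : SymbolRel (fun b => (f b).getLeft?) (inputAt w h) y)
    (hmv : a.inputMove ≠ .left) :
    ∃ z' h' m' t', z.length ≤ z'.length ∧ (count K f).perform w (countConfig f zero h m t c)
        ⟨.sim zero a.state, a.inputMove, ((markedTape m t c.workHead).1,
          some (a.write, ((markedTape m t c.workHead).2.getD (K.blank, 0)).2)), a.workMove,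
          mapStackOp some a.stackOp⟩ =
        countConfig f zero h' m' t' (K.perform (lettersOf f w) c a) ∧
      CountInv f w B z' (j + 1) (K.perform (lettersOf f w) c a) h' m' t' A zero := by
  obtain ⟨-, z', hpos, htot, hlen⟩ := hI.pos.next hy hmv
  refine ⟨z', _, max m (c.workHead + 1), Function.update t c.workHead (a.write, (t c.workHead).2),
    hlen, ?_, hpos, hI.reaches.step ⟨a, ha, rfl⟩, ?_, ?_, ?_, ?_, ?_, ?_, ?_, ?_⟩
  · rw [markedTape_getD hI.blank]
    simp only [perform, countConfig, mapStackOp_apply]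
    congr 1
    exact update_markedTape_write t _ hI.head_le
  · intro i
    by_cases hi : i = c.workHead
    · subst hi; simp [perform]
    · simp [perform, Function.update_of_ne hi, hI.tape]
  · intro i hi
    rw [Function.update_of_ne (by omega)]
    exact hI.blank i (by omega)
  · simp only [perform]
    cases a.workMove <;> simp only [HeadMove.apply] <;> omega
  · have := hI.lt; omega
  · rw [htot]; exact hI.zero_iff
  · have e : (fun i => (Function.update t c.workHead (a.write, (t c.workHead).2) i).2) =
        fun i => (t i).2 := by
      funext i
      by_cases hi : i = c.workHead
      · subst hi; simp
      · simp [Function.update_of_ne hi]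
    rw [e, htot, ← hI.value_eq]
    -- The step of `K` may open one new cell; its digit is 0, so the value of the counter is
    -- unchanged.
    rcases le_total (c.workHead + 1) m with hm | hm
    · rw [max_eq_left hm]
    · have := hI.head_le
      rcases eq_or_lt_of_le hm with hm' | hm'
      · rw [← hm', max_self]
      · obtain rfl : m = c.workHead := by omega
        rw [max_eq_right hm, value_succ, hI.blank _ le_rfl]; simp
  · have e : (fun i => (Function.update t c.workHead (a.write, (t c.workHead).2) i).2) =
        fun i => (t i).2 := by
      funext i
      by_cases hi : i = c.workHead
      · subst hi; simp
      · simp [Function.update_of_ne hi]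
    rw [e]; exact hI.amortized
  · exact hI.le_length.trans hlen

theorem CountInv.count {b : β} {s : SignType}
    (hI : CountInv f w B z j c h m t A zero) (hB : Nat.log 2 w.length + 1 < B)
    (hb : inputAt w h = .letter b) (hs : f b = .inr s) :
    ∃ k h' m' t' A' zero', k ≤ 4 * B ∧ Run (count K f) w B k
        ((count K f).perform w (countConfig f zero h m t c)
          ⟨.walk s c.state, .right, markedTape m t c.workHead, .stay, .keep⟩)
        (countConfig f zero' h' m' t' c) ∧ CountInv f w B (z ++ [b]) j c h' m' t' A' zero' := by
  obtain ⟨rest, hw, hh, hp⟩ : ∃ rest, w = z ++ b :: rest ∧ h = z.length + 1 ∧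
      c.inputHead = (lettersOf f z).length + 1 := by
    rcases hI.pos with ⟨rfl, -⟩ | ⟨rest, rfl, rfl, hp⟩
    · cases hb
    · cases rest with
      | nil => rw [List.append_nil, inputAt_length_succ] at hb; cases hb
      | cons b' rest => rw [inputAt_append_cons] at hb; cases hb; exact ⟨rest, rfl, rfl, hp⟩
  set d := fun i => (t i).2 with hd
  have hlen : z.length + 1 ≤ w.length := by rw [hw]; simp
  have hwt : weight s ≤ 1 := by unfold weight; split <;> simp
  obtain ⟨k, hk, hr⟩ := count_add (K := K) (f := f) (w := w) (h := h + 1) (by omega) s c.state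
    hI.head_le hI.lt hI.blank c.stack
  -- The digit at `m` is 0, so the carry is absorbed there.
  have hadd_blank : ∀ i, m < i → add d s i = 0 := by
    intro i hi
    obtain ⟨i, rfl⟩ : ∃ i', i = i' + 1 := ⟨i - 1, by omega⟩
    have h₁ : d i = 0 := by simp [hd, hI.blank i (by omega)]
    have h₂ : d (i + 1) = 0 := by simp [hd, hI.blank (i + 1) (by omega)]
    simp [add, carry, h₁, h₂, carryOut_zero_left, digit_zero_left]
  have hadd_m : add d s m = carry d s m := by
    have : d m = 0 := by simp [hd, hI.blank m le_rfl]
    simp [add, this, digit_zero_left]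
  have htot : total f (z ++ [b]) = value (add d s) (m + 1) := by
    rw [value_succ, hadd_m, value_add, hI.value_eq, total_append]
    simp [total, hs]
  have hval : value (add d s) (if carry d s m = 0 then m else m + 1) = total f (z ++ [b]) := by
    rw [htot]
    split
    · next h0 => rw [value_succ, hadd_m, h0]; simp
    · rfl
  refine ⟨k, h + 1, if carry d s m = 0 then m else m + 1, fun j => ((t j).1, add d s j),
    fun i => A i + weight (carry d s i), allZero (add d s) m && decide (carry d s m = 0), hk, ?_,
    ?_, hI.reaches, hI.tape, ?_, ?_, ?_, ?_, hval, hI.amortized.add s, ?_⟩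
  rotate_left
  · refine .inr ⟨rest, by simp [hw], by simp [hh], ?_⟩
    rw [hp]; simp [lettersOf, hs]
  · intro i hi
    have hmi : m ≤ i := by
      split at hi <;> omega
    refine Prod.ext ?_ ?_
    · simp [hI.blank i hmi]
    · rcases eq_or_lt_of_le hmi with rfl | hlt
      · change add d s m = 0
        rw [hadd_m]
        by_contra h0
        rw [if_neg h0] at hi; omega
      · exact hadd_blank i hlt
  · have := hI.head_le; split <;> omega
  · split
    · exact hI.lt
    · next h0 =>
      -- The counter grows only on a nonzero carry into position `m`, and then `m` is at most
      -- logarithmic in the input length.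
      have := hI.amortized.le_log (n := w.length) h0 (by have := hI.le_length; omega)
      omega
  · rw [htot, value_eq_zero_iff, Bool.and_eq_true, allZero_iff, decide_eq_true_iff,
      Nat.forall_lt_succ_right, hadd_m]
  · have := hI.le_length
    simp [carry]; omega
  · have e : (AuxPDA.count K f).perform w (countConfig f zero h m t c)
        ⟨.walk s c.state, .right, markedTape m t c.workHead, .stay, .keep⟩ =
        ⟨.walk s c.state, h + 1, markedTape m t, c.workHead, c.stack.map some⟩ := by
      simp only [perform, countConfig, HeadMove.apply, StackOp.apply, Function.update_eq_self]
      congr 1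
      omega
    rw [e]
    exact hr

theorem countInv_initial (hB : 0 < B) :
    CountInv f w B [] 0 K.initial 0 0 (fun _ => (K.blank, 0)) (fun _ => 0) true where
  pos := .inl ⟨rfl, rfl, rfl⟩
  reaches := .initial
  tape _ := rfl
  blank _ _ := rfl
  head_le := le_rfl
  lt := hB
  zero_iff := by simp [total]
  value_eq := by simp [value, total]
  amortized _ := by simp [weight]
  le_length := le_rfl

theorem count_perform_init (w : List β) : (count K f).perform w (count K f).initial
    ⟨.sim true K.start, .stay, (true, none), .stay, .keep⟩ =
    countConfig f true 0 0 (fun _ => (K.blank, 0)) K.initial := by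
  simp only [perform, countConfig, initial, HeadMove.apply, StackOp.apply]
  congr 1
  funext i
  by_cases hi : i = 0 <;> simp [markedTape, Function.update, hi]

theorem count_bounds (hK : K.OneWay) {C : ℕ} {p : Polynomial ℕ}
    (hC : ∀ (w : List α) (k : ℕ) (c : K.Config), K.Reaches w k c →
      c.workHead < C * (Nat.log 2 w.length + 1))
    (hp : ∀ (w : List α) (k : ℕ) (c : K.Config), K.Reaches w k c → k ≤ p.eval w.length)
    (w : List β) {k : ℕ} {c : (count K f).Config} (hc : (count K f).Reaches w k c) :
    c.workHead < (C + 1) * (Nat.log 2 w.length + 1) + 1 ∧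
    k ≤ (p.eval w.length + w.length + 1) *
      (4 * ((C + 1) * (Nat.log 2 w.length + 1) + 1) + 2) ∧
    (c.inputHead = w.length + 1 → c.state ∈ (count K f).accepting →
      lettersOf f w ∈ K.accepts ∧ total f w = 0) := by
  -- The summand `C` covers the cells of `K`, the summand 1 those of the counter, which share the
  -- tape.
  set B := (C + 1) * (Nat.log 2 w.length + 1) + 1 with hBdef
  have hlen : (lettersOf f w).length ≤ w.length := List.length_filterMap_le _ _
  have hlog : Nat.log 2 w.length + 1 < B := by
    rw [hBdef, add_mul]; omega
  have hhead : ∀ {j c}, K.Reaches (lettersOf f w) j c → c.workHead + 1 < B := by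
    intro j c hr
    have h₁ := hC _ _ _ hr
    have h₂ : C * (Nat.log 2 (lettersOf f w).length + 1) ≤ C * (Nat.log 2 w.length + 1) :=
      Nat.mul_le_mul_left _ (Nat.succ_le_succ (Nat.log_mono_right hlen))
    rw [hBdef, add_mul]
    omega
  let Main (n : ℕ) (c : (count K f).Config) : Prop := ∃ z j c' h m t A zero,
    c = countConfig f zero h m t c' ∧ CountInv f w B z j c' h m t A zero ∧ n ≤ j + z.length
  have key := reaches_of_main (M := count K f) (w := w) (N := p.eval w.length + w.length)
    (T := 4 * B + 1) (B := B) Main ?_ ?_ ?_ ?_ hc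
  · refine ⟨key.1, key.2.1, fun hend hacc => ?_⟩
    obtain ⟨n, z, j, c', h, m, t, A, zero, rfl, hI, -⟩ := key.2.2 hacc
    obtain ⟨q, hq, he⟩ := hacc
    change CountState.sim zero c'.state = .sim true q at he
    cases he
    change h = w.length + 1 at hend
    rcases hI.pos with ⟨rfl, -⟩ | ⟨rest, rfl, rfl, hp⟩
    · cases hend
    · obtain rfl : rest = [] := by simpa using hend
      rw [List.append_nil] at *
      exact ⟨⟨j, c', hI.reaches, hp, hq⟩, hI.zero_iff.1 rfl⟩
  · refine ⟨1, _, by omega, ?_, [], 0, K.initial, 0, 0, _, _, true, rfl,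
      countInv_initial (by omega), le_rfl⟩
    refine .of_trans_eq (M := count K f) ⟨.sim true K.start, .stay, (true, none), .stay, .keep⟩ rfl
      (by simp [initial, hBdef]) (by rintro ⟨_, _, ⟨⟩⟩) ?_
    rw [count_perform_init]
    exact .refl _
  · rintro n c c₁ ⟨z, j, c', h, m, t, A, zero, rfl, hI, hn⟩ ⟨a, ha, rfl⟩
    rcases ha with ⟨y, g, a, ha, hy, hg, rfl⟩ | ⟨b, s, hb, hs, rfl⟩
    · have hmv := hK _ _ _ _ a ha
      obtain rfl := (hI.pos.next hy hmv).1
      have hg' : c'.stack.head? = g := by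
        have : (c'.stack.map some).head? = g.map some := hg
        rw [List.head?_map] at this
        exact Option.map_injective (Option.some_injective _) this
      have e : ((markedTape m t c'.workHead).2.getD (K.blank, 0)).1 = c'.workTape c'.workHead := by
        rw [markedTape_getD hI.blank, hI.tape]
      have ha' : a ∈ K.trans c'.state (inputAt (lettersOf f w) c'.inputHead)
          (c'.workTape c'.workHead) c'.stack.head? := by
        rw [← e, hg']; exact ha
      obtain ⟨z', h', m', t', hz, he, hI'⟩ := hI.next (hhead hI.reaches) ha' hy hmv
      refine ⟨0, countConfig f zero h' m' t' (K.perform (lettersOf f w) c' a), by omega, ?_,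
        z', j + 1, _, h', m', t', A, zero, rfl, hI', by omega⟩
      rw [← he]
      exact .refl _
    · obtain ⟨k, h', m', t', A', zero', hk, hr, hI'⟩ := hI.count hlog hb hs
      exact ⟨k, _, by omega, hr, _, _, _, _, _, _, _, _, rfl, hI', by simp; omega⟩
  · rintro n c ⟨z, j, c', h, m, t, A, zero, rfl, hI, hn⟩
    have h₁ := (hp _ _ _ hI.reaches).trans (p.eval_nat_mono hlen)
    have h₂ := hI.pos.length_le
    omega
  · rintro n c ⟨z, j, c', h, m, t, A, zero, rfl, hI, hn⟩
    exact hI.head_le.trans_lt hI.lt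

end

end AuxPDA

/-! ### The counting machine: completeness -/

namespace AuxPDA

open SignedDigit Relation

variable {α β : Type*} {K : AuxPDA α} {f : β → α ⊕ SignType} {w : List β} {B : ℕ}

/-- Counter letters are invisible to `K`, so they are consumed before each of its steps and once
more at the end. The number `n` bounds the unread letters. -/
theorem count_reaches_noncounting (hB : Nat.log 2 w.length + 1 < B) (n : ℕ) {z : List β} {j : ℕ}
    {c : K.Config} {h m : ℕ} {t : ℕ → K.W × SignType} {A : ℕ → ℕ} {zero : Bool}
    (hn : w.length ≤ z.length + n) (hI : CountInv f w B z j c h m t A zero) :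
    ∃ z' h' m' t' A' zero', CountInv f w B z' j c h' m' t' A' zero' ∧
      ReflTransGen ((count K f).Step w) (countConfig f zero h m t c)
        (countConfig f zero' h' m' t' c) ∧
      ∀ b s, inputAt w h' = .letter b → f b ≠ .inr s := by
  induction n generalizing z h m t A zero with
  | zero =>
    refine ⟨_, _, _, _, _, _, hI, .refl, fun b s hb hs => ?_⟩
    obtain ⟨k, h', m', t', A', zero', -, -, hI'⟩ := hI.count hB hb hs
    have := hI'.pos.length_le
    simp at this; omega
  | succ n ih =>
    by_cases hw : ∃ b s, inputAt w h = .letter b ∧ f b = .inr s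
    · obtain ⟨b, s, hb, hs⟩ := hw
      obtain ⟨k, h', m', t', A', zero', -, hr, hI'⟩ := hI.count hB hb hs
      obtain ⟨z', h'', m'', t'', A'', zero'', hI'', hr', hend⟩ := ih (by simp; omega) hI'
      exact ⟨_, _, _, _, _, _, hI'',
        .head ⟨_, .inr ⟨b, s, hb, hs, rfl⟩, rfl⟩ (hr.reflTransGen.trans hr'), hend⟩
    · push Not at hw
      exact ⟨_, _, _, _, _, _, hI, .refl, hw⟩

theorem count_reaches (hK : K.OneWay) (hB : Nat.log 2 w.length + 1 < B)
    (hB' : ∀ j c, K.Reaches (lettersOf f w) j c → c.workHead + 1 < B) {c d : K.Config}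
    (hcd : ReflTransGen (K.Step (lettersOf f w)) c d) {z : List β} {j h m : ℕ}
    {t : ℕ → K.W × SignType} {A : ℕ → ℕ} {zero : Bool} (hI : CountInv f w B z j c h m t A zero) :
    ∃ z' j' h' m' t' A' zero', CountInv f w B z' j' d h' m' t' A' zero' ∧
      ReflTransGen ((count K f).Step w) (countConfig f zero h m t c)
        (countConfig f zero' h' m' t' d) := by
  induction hcd using ReflTransGen.head_induction_on generalizing z j h m t A zero with
  | refl => exact ⟨_, _, _, _, _, _, _, hI, .refl⟩
  | head hs _ ih =>
    obtain ⟨a, ha, rfl⟩ := hs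
    obtain ⟨z₁, h₁, m₁, t₁, A₁, zero₁, hI₁, hr₁, hw⟩ :=
      count_reaches_noncounting hB w.length (by omega) hI
    have hy := hI₁.pos.symbolRel hw
    obtain ⟨z₂, h₂, m₂, t₂, -, he, hI₂⟩ := hI₁.next (hB' _ _ hI₁.reaches) ha hy (hK _ _ _ _ a ha)
    obtain ⟨z', j', h', m', t', A', zero', hI', hr'⟩ := ih hI₂
    refine ⟨z', j', h', m', t', A', zero', hI', hr₁.trans (.head ⟨_, .inl ⟨_, _, a, ?_, hy,
      List.head?_map, rfl⟩, he.symm⟩ hr')⟩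
    change a ∈ K.trans _ _ (((markedTape m₁ t₁ _).2.getD (K.blank, 0)).1) _
    rw [markedTape_getD hI₁.blank, hI₁.tape]
    exact ha

theorem count_accepts (hK : K.OneWay) {C : ℕ}
    (hC : ∀ (w : List α) (k : ℕ) (c : K.Config), K.Reaches w k c →
      c.workHead < C * (Nat.log 2 w.length + 1))
    (hw : lettersOf f w ∈ K.accepts) (htot : total f w = 0) : w ∈ (count K f).accepts := by
  obtain ⟨d, hd, hend, hq⟩ := mem_accepts_iff.1 hw
  obtain ⟨B, hB, hB'⟩ : ∃ B, Nat.log 2 w.length + 1 < B ∧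
      C * (Nat.log 2 (lettersOf f w).length + 1) < B :=
    ⟨Nat.log 2 w.length + 1 + C * (Nat.log 2 (lettersOf f w).length + 1) + 1, by omega, by omega⟩
  obtain ⟨z₁, j₁, h₁, m₁, t₁, A₁, zero₁, hI₁, hr₁⟩ := count_reaches hK hB
    (fun j c hr => by have := hC _ _ _ hr; omega) hd (countInv_initial (by omega))
  obtain ⟨z, h, m, t, A, zero, hI, hr, hlast⟩ :=
    count_reaches_noncounting hB w.length (by omega) hI₁
  rcases hI.pos with ⟨-, h0, -⟩ | ⟨rest, rfl, rfl, hp⟩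
  · omega
  -- Once the trailing counter letters are consumed, an unread letter would be a letter for `K`,
  -- whose head is already on the right end marker.
  obtain rfl : rest = [] := by
    cases rest with
    | nil => rfl
    | cons b rest =>
      rw [inputAt_append_cons] at hlast
      cases hb : f b with
      | inr s => exact absurd hb (hlast b s rfl)
      | inl a =>
        rw [hp, lettersOf_append] at hend
        simp [lettersOf, hb] at hend
  rw [List.append_nil] at *
  obtain rfl : zero = true := hI.zero_iff.2 htot
  exact mem_accepts_iff.2 ⟨_, .head ⟨_, rfl, (count_perform_init z).symm⟩ (hr₁.trans hr), rfl,
    _, hq, rfl⟩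

end AuxPDA

open AuxPDA in
/-- The words whose letters of the form `inl a` form a word of a recognized language, and whose
letters of the form `inr s` have the sum `0`, form a recognized language. -/
theorem RecognizedByOneWayAuxPDA.counting {α β : Type*} {L : Language α}
    (hL : RecognizedByOneWayAuxPDA L) (f : β → α ⊕ SignType) :
    RecognizedByOneWayAuxPDA ({w | lettersOf f w ∈ L ∧ total f w = 0} : Language β) := by
  obtain ⟨K, hK, ⟨C, hC⟩, ⟨p, hp⟩, rfl⟩ := hL
  refine ⟨AuxPDA.count K f, count_oneWay hK f, ⟨C + 2, fun w k c h => ?_⟩,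
    ⟨(p + .X + 1) * (4 * ((.C C + 1) * (.X + 1) + 1) + 2), fun w k c h => ?_⟩, ?_⟩
  · have := (count_bounds hK hC hp w h).1
    rw [show C + 2 = (C + 1) + 1 from rfl, add_mul]; omega
  · refine (count_bounds hK hC hp w h).2.1.trans ?_
    have hlog : Nat.log 2 w.length ≤ w.length := Nat.log_le_self _ _
    simp only [Polynomial.eval_mul, Polynomial.eval_add, Polynomial.eval_X, Polynomial.eval_C,
      Polynomial.eval_one, Polynomial.eval_ofNat]
    gcongr
  · ext w
    constructor
    · rintro ⟨k, c, h, hend, hq⟩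
      exact (count_bounds hK hC hp w h).2.2 hend hq
    · rintro ⟨h₁, h₂⟩
      exact count_accepts hK hC h₁ h₂

/-! ### The two closure properties for groups -/

theorem RecognizedByOneWayAuxPDA.congr {α : Type*} {L L' : Language α}
    (hL : RecognizedByOneWayAuxPDA L) (h : ∀ w, w ∈ L' ↔ w ∈ L) : RecognizedByOneWayAuxPDA L' := by
  rwa [show L' = L from Set.ext h]

theorem exists_partial_lift {σ β X : Type*} (g : σ → X) (val : β → X) :
    ∃ f : β → Option σ, (∀ b s, f b = some s → g s = val b) ∧
      ∀ b, (∃ s, g s = val b) → f b ≠ none := by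
  have h : ∀ b, ∃ o : Option σ, (∀ s, o = some s → g s = val b) ∧
      ((∃ s, g s = val b) → o ≠ none) := by
    intro b
    by_cases h : ∃ s, g s = val b
    · obtain ⟨s, hs⟩ := h
      exact ⟨some s, by simp [hs], by simp⟩
    · exact ⟨none, by simp, fun h' => absurd h' h⟩
  choose f hf using h
  exact ⟨f, fun b => (hf b).1, fun b => (hf b).2⟩

open Monoid in
theorem InOWAuxPDA.coprod {G H : Type*} [Group G] [Group H] (hG : InOWAuxPDA G)
    (hH : InOWAuxPDA H) : InOWAuxPDA (Coprod G H) := by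
  obtain ⟨S, hSfin, hSinv, hScl, hS⟩ := hG
  obtain ⟨T, hTfin, hTinv, hTcl, hT⟩ := hH
  set U : Set (Coprod G H) := Coprod.inl '' S ∪ Coprod.inr '' T with hU
  have hUfin : U.Finite := (hSfin.image _).union (hTfin.image _)
  refine ⟨U, hUfin, ?_, ?_, ?_⟩
  · rintro _ (⟨s, hs, rfl⟩ | ⟨s, hs, rfl⟩)
    · exact .inl ⟨s⁻¹, hSinv s hs, map_inv _ _⟩
    · exact .inr ⟨s⁻¹, hTinv s hs, map_inv _ _⟩
  · rw [hU, Subgroup.closure_union, ← MonoidHom.map_closure, ← MonoidHom.map_closure, hScl, hTcl,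
      ← MonoidHom.range_eq_map, ← MonoidHom.range_eq_map]
    exact Coprod.range_inl_sup_range_inr
  · have := hUfin.to_subtype
    -- The nesting machine stores scanned letters in its states and stack symbols, so its alphabet
    -- has to be a finite type in `Type`.
    let e := Finite.equivFin U
    let val : Fin (Nat.card U) → Coprod G H := fun i => e.symm i
    obtain ⟨fG, hfG, hfG'⟩ := exists_partial_lift (fun s : S => (Coprod.inl (s : G) : Coprod G H)) val
    obtain ⟨fH, hfH, hfH'⟩ := exists_partial_lift (fun t : T => (Coprod.inr (t : H) : Coprod G H)) val
    have hcover : ∀ b, fG b = none → fH b ≠ none := by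
      intro b h₁ h₂
      rcases (e.symm b).2 with ⟨s, hs, h⟩ | ⟨t, ht, h⟩
      · exact hfG' b ⟨⟨s, hs⟩, h⟩ h₁
      · exact hfH' b ⟨⟨t, ht⟩, h⟩ h₂
    -- The alphabets `S` and `T` may lie in different universes. Unions over `Unit` first translate
    -- both languages to the common alphabet; only then are they united.
    have hrec := RecognizedByOneWayAuxPDA.iUnion (ι := Bool)
      (L := fun i => cond i
        ({w | ∃ _ : Unit, ∃ u ∈ wordProblem S, w.map fG = u.map some} : Language _)
        ({w | ∃ _ : Unit, ∃ u ∈ wordProblem T, w.map fH = u.map some} : Language _))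
      (fun i => by
        cases i
        · exact RecognizedByOneWayAuxPDA.iUnion (ι := Unit) (fun _ => hT) fun _ => fH
        · exact RecognizedByOneWayAuxPDA.iUnion (ι := Unit) (fun _ => hS) fun _ => fG)
      fun _ => (some : Fin (Nat.card U) → _)
    have hsome : Function.Injective (List.map (some : Fin (Nat.card U) → _)) :=
      List.map_injective_iff.2 (Option.some_injective _)
    refine (hrec.insertionClosure e).congr fun w => ?_
    have hmem := wordProblem_coprod_iff val fG fH hfG hfH hcover (L := {w | ∃ i : Bool, ∃ u ∈ cond i
        ({w | ∃ _ : Unit, ∃ u ∈ wordProblem S, w.map fG = u.map some} : Language _)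
        ({w | ∃ _ : Unit, ∃ u ∈ wordProblem T, w.map fH = u.map some} : Language _),
        w.map some = u.map some}) (fun w => ⟨?_, ?_⟩) (w.map e)
    · refine Iff.trans ?_ hmem
      rw [List.map_map, show val ∘ e = fun a : U => (a : Coprod G H) from
        funext fun a => congrArg Subtype.val (e.symm_apply_apply a)]
      rfl
    · rintro ⟨_ | _, u, ⟨-, v, hv, h⟩, hu⟩
      · obtain rfl := hsome hu
        exact .inr ⟨v, hv, h⟩
      · obtain rfl := hsome hu
        exact .inl ⟨v, hv, h⟩
    · rintro (⟨v, hv, h⟩ | ⟨v, hv, h⟩)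
      · exact ⟨true, w, ⟨(), v, hv, h⟩, rfl⟩
      · exact ⟨false, w, ⟨(), v, hv, h⟩, rfl⟩

theorem InOWAuxPDA.prod_int {G : Type*} [Group G] (hG : InOWAuxPDA G) :
    InOWAuxPDA (G × Multiplicative ℤ) := by
  classical
  obtain ⟨S, hSfin, hSinv, hScl, hS⟩ := hG
  let gen (s : SignType) : G × Multiplicative ℤ := (1, Multiplicative.ofAdd (s : ℤ))
  set U : Set (G × Multiplicative ℤ) := MonoidHom.inl G (Multiplicative ℤ) '' S ∪ Set.range gen
    with hU
  refine ⟨U, (hSfin.image _).union (Set.finite_range _), ?_, ?_, ?_⟩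
  · rintro _ (⟨s, hs, rfl⟩ | ⟨s, rfl⟩)
    · exact .inl ⟨s⁻¹, hSinv s hs, map_inv _ _⟩
    · refine .inr ⟨-s, ?_⟩
      cases s <;> simp [gen]
  · rw [hU, Subgroup.closure_union, ← MonoidHom.map_closure, hScl, eq_top_iff]
    rintro ⟨g, n⟩ -
    have h₁ : (g, (1 : Multiplicative ℤ)) ∈
        (⊤ : Subgroup G).map (MonoidHom.inl G (Multiplicative ℤ)) :=
      Subgroup.mem_map.2 ⟨g, Subgroup.mem_top _, rfl⟩
    have h₂ : ((1 : G), n) ∈ Subgroup.closure (Set.range gen) := by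
      have : gen 1 ^ (Multiplicative.toAdd n) = ((1 : G), n) := by
        refine Prod.ext (by simp [gen]) ?_
        apply Multiplicative.toAdd.injective
        simp [gen, toAdd_zpow]
      rw [← this]
      exact Subgroup.zpow_mem _ (Subgroup.subset_closure (Set.mem_range_self (f := gen) 1)) _
    have := Subgroup.mul_mem_sup h₁ h₂
    simpa using this
  -- The two kinds of generators may overlap in the identity, which is then treated as a letter of
  -- `S`. For the others, the sign of the exponent recovers the digit, as exponents lie in {-1, 0,
  -- 1}.
  · let f : U → S ⊕ SignType := fun x =>
      if h : (x : G × Multiplicative ℤ).2 = 1 ∧ (x : G × Multiplicative ℤ).1 ∈ S then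
        .inl ⟨_, h.2⟩
      else .inr (SignType.sign (Multiplicative.toAdd (x : G × Multiplicative ℤ).2))
    have hf₁ : ∀ x a, f x = .inl a → (x : G × Multiplicative ℤ) = ((a : G), 1) := by
      intro x a hx
      by_cases h : (x : G × Multiplicative ℤ).2 = 1 ∧ (x : G × Multiplicative ℤ).1 ∈ S
      · simp only [f, dif_pos h, Sum.inl.injEq] at hx
        subst hx
        exact Prod.ext rfl h.1
      · simp [f, dif_neg h] at hx
    have hf₂ : ∀ x s, f x = .inr s → (x : G × Multiplicative ℤ) = gen s := by
      intro x s hx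
      by_cases h : (x : G × Multiplicative ℤ).2 = 1 ∧ (x : G × Multiplicative ℤ).1 ∈ S
      · simp [f, dif_pos h] at hx
      · simp only [f, dif_neg h, Sum.inr.injEq] at hx
        rcases x.2 with ⟨g, hg, hgx⟩ | ⟨s', hs'⟩
        · exact (h ⟨by rw [← hgx]; rfl, by rw [← hgx]; exact hg⟩).elim
        · rw [← hs'] at hx ⊢
          rw [← hx]
          cases s' <;> simp [gen]
    have key : ∀ w : List U, (w.map fun a : U => (a : G × Multiplicative ℤ)).prod =
        (((AuxPDA.lettersOf f w).map fun a : S => (a : G)).prod,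
          Multiplicative.ofAdd (AuxPDA.total f w)) := by
      intro w
      induction w with
      | nil => simp [AuxPDA.lettersOf, AuxPDA.total]; rfl
      | cons x w ih =>
        rw [List.map_cons, List.prod_cons, ih]
        cases hx : f x with
        | inl a => simp [hf₁ x a hx, AuxPDA.lettersOf, AuxPDA.total, hx]
        | inr s => simp [hf₂ x s hx, AuxPDA.lettersOf, AuxPDA.total, hx, gen]
    refine (hS.counting f).congr fun w => ?_
    change (w.map fun a : U => (a : G × Multiplicative ℤ)).prod = 1 ↔ _ ∧ _
    rw [key, Prod.mk_eq_one, ofAdd_eq_one]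
    rfl

theorem mainTheorem6 {G H : Type*} [Group G] [Group H] (hG : InOWAuxPDA G) :
    (InOWAuxPDA H → InOWAuxPDA (Monoid.Coprod G H)) ∧
      InOWAuxPDA (G × Multiplicative ℤ) :=
  ⟨hG.coprod, hG.prod_int⟩
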